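/- **Setting.** Let $A,D\in\mathbb C^{n\times n}$ and let $[\Xi\ \Xi_c]\in\mathbb C^{n\times n}$ be invertible with $[\Sigma\ \Sigma_c]=[\Xi\ \Xi_c]^{-*}$ and $$A[\Xi\ \Xi_c]=[\Xi\ \Xi_c]\begin{bmatrix}\lambda_0I+N&0\\0&A_{22}\end{bmatrix},\qquad N=\operatorname{diag}(N_1,\dots,N_k),$$ where $\lambda_0$ is not an eigenvalue of $A_{22}$ and $N_j$ is the $j\times j$ block matrix with blocks $I_{s_j}$ on the first block superdiagonal and zero blocks elsewhere ($s_1,\dots,s_{k-1}\ge 0$, $s_k>0$). Partition the columns of $\Xi$ and $\Sigma$ accordingly into blocks $\Xi_{jl},\Sigma_{jl}\in\mathbb C^{n\times s_j}$, $1\le l\le j\le k$, and put $B^{(ij)}_{lm}=\Sigma_{il}^*D\,\Xi_{jm}$, $\widetilde\Xi_i=[\Xi_{i1},\Xi_{i+1,1},\dots,\Xi_{k1}]$, $\widetilde\Xi_{i2}=[\Xi_{i2},\Xi_{i+1,2},\dots,\Xi_{k2}]$ and $W_i=[B^{(ab)}_{a1}]_{a,b=i,\dots,k}$. Let $2\le\rho\le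 k$ and suppose that $W_1,\dots,W_\rho$, and also $W_{\rho+1}$ if $\rho<k$, are invertible. (Terms with block indices greater than $k$ are void.) **Notation.** For $j\le\rho$ let $$G_j^{(\rho)}=-W_{\rho+1}^{-1}\begin{bmatrix}B^{(\rho+1,j)}_{\rho+1,1}\\\vdots\\B^{(kj)}_{k1}\end{bmatrix},\qquad G_\rho^{(\rho)}=\begin{bmatrix}G_{\rho+1,\rho}\\\vdots\\G_{k\rho}\end{bmatrix},$$ and let $W_{\rho,\rho+1}=[B^{(\rho,\rho+1)}_{\rho1},\dots,B^{(\rho k)}_{\rho1}]$, $S_\rho=B^{(\rho\rho)}_{\rho1}+W_{\rho,\rho+1}G_\rho^{(\rho)}$. Let $\Theta_\rho$ be the $\rho\times\rho$ block matrix with $I_{s_\rho}$ on the first block superdiagonal, $S_\rho$ in the lower left corner and zero blocks elsewhere. Put $$\widehat B^{(j\rho)}_{l1}=B^{(j\rho)}_{l1}+[B^{(j,\rho+1)}_{l1},\dots,B^{(jk)}_{l1}]G_\rho^{(\rho)},$$ let $\widetilde C$ have the block rows, for $\rho+1\le j\le k$, $$\widetilde C_j=\delta_{j,\rho+1}G_{\rho+1,\rho}S_\rho-\Big(\widehat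 B^{(j\rho)}_{j-1,1}+B^{(j\rho)}_{j2}+[B^{(j,\rho+1)}_{j2},\dots,B^{(jk)}_{j2}]G_\rho^{(\rho)}\Big),$$ and let $$C=\begin{bmatrix}C_{\rho+1}\\\vdots\\C_k\end{bmatrix}=W_{\rho+1}^{-1}\widetilde C+G_{\rho-1}^{(\rho)}\widehat B^{(\rho-1,\rho)}_{\rho-1,1}S_\rho^{-1},$$ $$\widehat B^{(\rho\rho)}_{\rho2}=B^{(\rho\rho)}_{\rho2}+B^{(\rho,\rho-1)}_{\rho1}\widehat B^{(\rho-1,\rho)}_{\rho-1,1}S_\rho^{-1}+W_{\rho,\rho+1}C+[B^{(\rho,\rho+1)}_{\rho2},\dots,B^{(\rho k)}_{\rho2}]G_\rho^{(\rho)}.$$ Let $[\widetilde\Phi_\rho\ \widetilde\Phi_c]$ be invertible with $\Theta_\rho\widetilde\Phi_\rho=\widetilde\Phi_\rho\Omega$ and $\Theta_\rho\widetilde\Phi_c=\widetilde\Phi_c\Omega_c$, where $\Omega\in\mathbb C^{r\times r}$ and $\Omega_c$ have no common eigenvalue, and let $Q_1,Q_2$ be the top blocks (the first $s_\rho$ rows)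 of $\widetilde\Phi_\rho,\widetilde\Phi_c$. Let $\widetilde Q_1,\widetilde Q_2$ satisfy $\widetilde Q_1S_\rho=\Omega^\rho\widetilde Q_1$, $\widetilde Q_2S_\rho=\Omega_c^\rho\widetilde Q_2$ and be such that the inverses $$M=\Big(\sum_{j=0}^{\rho-1}\Omega^{\rho-1-j}\widetilde Q_1Q_1\Omega^j\Big)^{-1},\qquad M_c=\Big(\sum_{j=0}^{\rho-1}\Omega_c^{\rho-1-j}\widetilde Q_2Q_2\Omega_c^j\Big)^{-1}$$ exist. Put $$\begin{bmatrix}\Delta_{11}&\Delta_{12}\\\Delta_{21}&\Delta_{22}\end{bmatrix}=\begin{bmatrix}M&0\\0&M_c\end{bmatrix}\begin{bmatrix}\Omega\widetilde Q_1&\widetilde Q_1\\\Omega_c\widetilde Q_2&\widetilde Q_2\end{bmatrix}\begin{bmatrix}\widehat B^{(\rho\rho)}_{\rho-1,1}&0\\0&\widehat B^{(\rho\rho)}_{\rho2}\end{bmatrix}\begin{bmatrix}Q_1&Q_2\\Q_1\Omega&Q_2\Omega_c\end{bmatrix},$$ let $Y$ solve $\Omega_cY-Y\Omega+\Delta_{21}=0$,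 and let $$H_0=\widetilde\Xi_\rho\begin{bmatrix}I\\G_\rho^{(\rho)}\end{bmatrix}Q_1,$$ $$H_1=\widetilde\Xi_{\rho-1}\begin{bmatrix}\widehat B^{(\rho-1,\rho)}_{\rho-1,1}S_\rho^{-1}\\0\\C_{\rho+1}\\\vdots\\C_k\end{bmatrix}Q_1\Omega+\widetilde\Xi_\rho\begin{bmatrix}I\\G_\rho^{(\rho)}\end{bmatrix}Q_2Y+\widetilde\Xi_{\rho2}\begin{bmatrix}I\\G_\rho^{(\rho)}\end{bmatrix}Q_1\Omega.$$ **Theorem.** As $t\to0^+$ the following hold. 1. There are matrices $H(t)\in\mathbb C^{n\times r}$ and $C(t)\in\mathbb C^{r\times r}$ such that, for all sufficiently small $t>0$, $H(t)$ has rank $r$ and $(A+tD)H(t)=H(t)C(t)$, and $$C(t)=\lambda_0I+t^{1/\rho}\Omega+t^{2/\rho}\Delta_{11}+O(t^{3/\rho}),\qquad H(t)=H_0+t^{1/\rho}H_1+O(t^{2/\rho}).$$ 2. $(A+tD)(H_0+t^{1/\rho}H_1)=(H_0+t^{1/\rho}H_1)\big(\lambda_0I+t^{1/\rho}\Omega+t^{2/\rho}\Delta_{11}\big)+O(t^{2/\rho}).$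 -/

import Mathlib

open Matrix Filter Topology Asymptotics

noncomputable section

namespace JordanPert

/-- Coordinates of the `lam0`-part of `A` in its modified Jordan form with `s i` Jordan blocks of
size `i`, `1 ≤ i ≤ k`: the coordinate `(i, l, x)` is the `x`-th coordinate in sub-block `l`
(`1 ≤ l ≤ i`) of block `i`. All block indices start at `1`. -/
abbrev JIdx (k : ℕ) (s : ℕ → ℕ) : Type :=
  (i : Set.Icc 1 k) × (Set.Icc 1 (i : ℕ) × Fin (s i))

/-- Coordinates for one sub-block from each of the blocks `i, i + 1, …, k`
(empty if `i > k`). -/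
abbrev TIdx (i k : ℕ) (s : ℕ → ℕ) : Type :=
  (j : Set.Icc i k) × Fin (s j)

variable {k : ℕ} {s : ℕ → ℕ}

/-- `N = diag(N_1, …, N_k)`, where `N_j` is the `j × j` block matrix with identity blocks of order
`s j` on the first block superdiagonal. -/
def jordanN (k : ℕ) (s : ℕ → ℕ) : Matrix (JIdx k s) (JIdx k s) ℂ :=
  Matrix.of fun p q =>
    if (p.1 : ℕ) = q.1 ∧ (q.2.1 : ℕ) = p.2.1 + 1 ∧ (p.2.2 : ℕ) = q.2.2 then 1 else 0

/-- The sub-block `X_{il}` of the columns of `X` (zero when the block is void, that is, unless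
`1 ≤ i ≤ k` and `1 ≤ l ≤ i`). -/
def colBlk {ι : Type*} (X : Matrix ι (JIdx k s) ℂ) (i l : ℕ) : Matrix ι (Fin (s i)) ℂ :=
  Matrix.of fun a x =>
    if h : (1 ≤ i ∧ i ≤ k) ∧ (1 ≤ l ∧ l ≤ i) then X a ⟨⟨i, h.1⟩, ⟨l, h.2⟩, x⟩ else 0

/-- The block row `[X_{il}, X_{i+1,l}, …, X_{kl}]`. -/
def colsFrom {ι : Type*} (X : Matrix ι (JIdx k s) ℂ) (i l : ℕ) : Matrix ι (TIdx i k s) ℂ :=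
  Matrix.of fun a q => colBlk X q.1 l a q.2

/-- The sub-block `B^{(ij)}_{lm}` of `B` (zero when void). -/
def blk (B : Matrix (JIdx k s) (JIdx k s) ℂ) (i j l m : ℕ) : Matrix (Fin (s i)) (Fin (s j)) ℂ :=
  (colBlk (colBlk B j m)ᵀ i l)ᵀ

/-- The block row `[B^{(i,j)}_{lm}, B^{(i,j+1)}_{lm}, …, B^{(i,k)}_{lm}]`. -/
def blkRow (B : Matrix (JIdx k s) (JIdx k s) ℂ) (i j l m : ℕ) :
    Matrix (Fin (s i)) (TIdx j k s) ℂ :=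
  Matrix.of fun x q => blk B i q.1 l m x q.2

/-- `W_i = [B^{(ab)}_{a1}]`, with block indices `a, b = i, …, k`. -/
def W (B : Matrix (JIdx k s) (JIdx k s) ℂ) (i : ℕ) : Matrix (TIdx i k s) (TIdx i k s) ℂ :=
  Matrix.of fun p q => blk B p.1 q.1 p.1 1 p.2 q.2

/-- `Z_{i,j}` for `j < i`: the block column with blocks `B^{(aj)}_{a1}`, `a = i, …, k`. -/
def Z (B : Matrix (JIdx k s) (JIdx k s) ℂ) (i j : ℕ) : Matrix (TIdx i k s) (Fin (s j)) ℂ :=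
  Matrix.of fun p y => blk B p.1 j p.1 1 p.2 y

/-- `G_j^{(ρ)} = -W_{ρ+1}⁻¹ Z_{ρ+1,j}` for `j ≤ ρ`. -/
def G (B : Matrix (JIdx k s) (JIdx k s) ℂ) (ρ j : ℕ) : Matrix (TIdx (ρ + 1) k s) (Fin (s j)) ℂ :=
  -((W B (ρ + 1))⁻¹ * Z B (ρ + 1) j)

/-- `S_ρ = B^{(ρρ)}_{ρ1} + W_{ρ,ρ+1} G_ρ^{(ρ)}`. -/
def S (B : Matrix (JIdx k s) (JIdx k s) ℂ) (ρ : ℕ) : Matrix (Fin (s ρ)) (Fin (s ρ)) ℂ :=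
  blk B ρ ρ ρ 1 + blkRow B ρ (ρ + 1) ρ 1 * G B ρ ρ

/-- `Θ_ρ`: the `ρ × ρ` block matrix with identity blocks on the first block superdiagonal, `S_ρ` in
the lower left corner, and zero blocks elsewhere (`Θ_1 = S_1`). -/
def Theta (B : Matrix (JIdx k s) (JIdx k s) ℂ) (ρ : ℕ) :
    Matrix (Fin ρ × Fin (s ρ)) (Fin ρ × Fin (s ρ)) ℂ :=
  Matrix.of fun p q =>
    if (q.1 : ℕ) = p.1 + 1 then (if p.2 = q.2 then 1 else 0)
    else if (p.1 : ℕ) + 1 = ρ ∧ (q.1 : ℕ) = 0 then S B ρ p.2 q.2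
    else 0

/-- `B̂^{(jρ)}_{l1} = B^{(jρ)}_{l1} + [B^{(j,ρ+1)}_{l1}, …, B^{(jk)}_{l1}] G_ρ^{(ρ)}`. -/
def Bhat (B : Matrix (JIdx k s) (JIdx k s) ℂ) (ρ j l : ℕ) : Matrix (Fin (s j)) (Fin (s ρ)) ℂ :=
  blk B j ρ l 1 + blkRow B j (ρ + 1) l 1 * G B ρ ρ

/-- `C̃`: its block row `j`, for `ρ + 1 ≤ j ≤ k`, is
`δ_{j,ρ+1} G_{ρ+1,ρ} S_ρ - (B̂^{(jρ)}_{j-1,1} + B^{(jρ)}_{j2}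
  + [B^{(j,ρ+1)}_{j2}, …, B^{(jk)}_{j2}] G_ρ^{(ρ)})`. -/
def Ctilde (B : Matrix (JIdx k s) (JIdx k s) ℂ) (ρ : ℕ) :
    Matrix (TIdx (ρ + 1) k s) (Fin (s ρ)) ℂ :=
  Matrix.of fun p y =>
    (if (p.1 : ℕ) = ρ + 1 then (G B ρ ρ * S B ρ) p y else 0)
      - (Bhat B ρ p.1 (p.1 - 1) + blk B p.1 ρ p.1 2
          + blkRow B p.1 (ρ + 1) p.1 2 * G B ρ ρ) p.2 y

/-- `C = W_{ρ+1}⁻¹ C̃ + G_{ρ-1}^{(ρ)} B̂^{(ρ-1,ρ)}_{ρ-1,1} S_ρ⁻¹`, with blocks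
`C_{ρ+1}, …, C_k`. -/
def Cmat (B : Matrix (JIdx k s) (JIdx k s) ℂ) (ρ : ℕ) :
    Matrix (TIdx (ρ + 1) k s) (Fin (s ρ)) ℂ :=
  (W B (ρ + 1))⁻¹ * Ctilde B ρ + G B ρ (ρ - 1) * Bhat B ρ (ρ - 1) (ρ - 1) * (S B ρ)⁻¹

/-- `B̂^{(ρρ)}_{ρ2} = B^{(ρρ)}_{ρ2} + B^{(ρ,ρ-1)}_{ρ1} B̂^{(ρ-1,ρ)}_{ρ-1,1} S_ρ⁻¹ + W_{ρ,ρ+1} C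
  + [B^{(ρ,ρ+1)}_{ρ2}, …, B^{(ρk)}_{ρ2}] G_ρ^{(ρ)}`. -/
def Bhat2 (B : Matrix (JIdx k s) (JIdx k s) ℂ) (ρ : ℕ) : Matrix (Fin (s ρ)) (Fin (s ρ)) ℂ :=
  blk B ρ ρ ρ 2 + blk B ρ (ρ - 1) ρ 1 * Bhat B ρ (ρ - 1) (ρ - 1) * (S B ρ)⁻¹
    + blkRow B ρ (ρ + 1) ρ 1 * Cmat B ρ + blkRow B ρ (ρ + 1) ρ 2 * G B ρ ρ

/-- `∑_{j<ρ} Ω^{ρ-1-j} Q̃ Q Ω^j`, the inverse of the normalizing factor `M`. -/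
def Msum {m r : ℕ} (ρ : ℕ) (Ω : Matrix (Fin r) (Fin r) ℂ) (Qt : Matrix (Fin r) (Fin m) ℂ)
    (Q : Matrix (Fin m) (Fin r) ℂ) : Matrix (Fin r) (Fin r) ℂ :=
  ∑ j ∈ Finset.range ρ, Ω ^ (ρ - 1 - j) * Qt * Q * Ω ^ j

/-- The `2 × 2` block matrix `Δ`, the product of
`diag(M, M_c)`, `[Ω Q̃_1, Q̃_1; Ω_c Q̃_2, Q̃_2]`, `diag(B̂^{(ρρ)}_{ρ-1,1}, B̂^{(ρρ)}_{ρ2})` and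
`[Q_1, Q_2; Q_1 Ω, Q_2 Ω_c]`. -/
def Delta (B : Matrix (JIdx k s) (JIdx k s) ℂ) (ρ : ℕ) {r r' : ℕ}
    (Ω : Matrix (Fin r) (Fin r) ℂ) (Ωc : Matrix (Fin r') (Fin r') ℂ)
    (Q1 : Matrix (Fin (s ρ)) (Fin r) ℂ) (Q2 : Matrix (Fin (s ρ)) (Fin r') ℂ)
    (Qt1 : Matrix (Fin r) (Fin (s ρ)) ℂ) (Qt2 : Matrix (Fin r') (Fin (s ρ)) ℂ) :
    Matrix (Fin r ⊕ Fin r') (Fin r ⊕ Fin r') ℂ :=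
  fromBlocks (Msum ρ Ω Qt1 Q1)⁻¹ 0 0 (Msum ρ Ωc Qt2 Q2)⁻¹
    * fromBlocks (Ω * Qt1) Qt1 (Ωc * Qt2) Qt2
    * fromBlocks (Bhat B ρ ρ (ρ - 1)) 0 0 (Bhat2 B ρ)
    * fromBlocks Q1 Q2 (Q1 * Ω) (Q2 * Ωc)

/-- The block column, with block rows `a, …, k`, whose block row `i` is `X`, whose block rows
`b, …, k` are those of `Y`, and whose other block rows are zero (used with `a ≤ i < b`). -/
def stack {κ : Type*} (a i b : ℕ) (X : Matrix (Fin (s i)) κ ℂ) (Y : Matrix (TIdx b k s) κ ℂ) :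
    Matrix (TIdx a k s) κ ℂ :=
  Matrix.of fun p c =>
    if h : (p.1 : ℕ) = i then X (Fin.cast (congrArg s h) p.2) c
    else if h' : b ≤ (p.1 : ℕ) then Y ⟨⟨p.1, h', p.1.2.2⟩, p.2⟩ c
    else 0

/-- `[I; G_ρ^{(ρ)}]`. -/
def IG (B : Matrix (JIdx k s) (JIdx k s) ℂ) (ρ : ℕ) : Matrix (TIdx ρ k s) (Fin (s ρ)) ℂ :=
  stack ρ ρ (ρ + 1) 1 (G B ρ ρ)

/-- `H_0 = Ξ̃_ρ [I; G_ρ^{(ρ)}] Q_1`. -/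
def H0 {n r : ℕ} (B : Matrix (JIdx k s) (JIdx k s) ℂ) (Xi : Matrix (Fin n) (JIdx k s) ℂ) (ρ : ℕ)
    (Q1 : Matrix (Fin (s ρ)) (Fin r) ℂ) : Matrix (Fin n) (Fin r) ℂ :=
  colsFrom Xi ρ 1 * IG B ρ * Q1

/-- `H_1 = Ξ̃_{ρ-1} [B̂^{(ρ-1,ρ)}_{ρ-1,1} S_ρ⁻¹; 0; C_{ρ+1}; …; C_k] Q_1 Ω
  + Ξ̃_ρ [I; G_ρ^{(ρ)}] Q_2 Y + Ξ̃_{ρ2} [I; G_ρ^{(ρ)}] Q_1 Ω`. -/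
def H1 {n r r' : ℕ} (B : Matrix (JIdx k s) (JIdx k s) ℂ) (Xi : Matrix (Fin n) (JIdx k s) ℂ)
    (ρ : ℕ) (Ω : Matrix (Fin r) (Fin r) ℂ) (Q1 : Matrix (Fin (s ρ)) (Fin r) ℂ)
    (Q2 : Matrix (Fin (s ρ)) (Fin r') ℂ) (Y : Matrix (Fin r') (Fin r) ℂ) :
    Matrix (Fin n) (Fin r) ℂ :=
  colsFrom Xi (ρ - 1) 1
      * stack (ρ - 1) (ρ - 1) (ρ + 1) (Bhat B ρ (ρ - 1) (ρ - 1) * (S B ρ)⁻¹) (Cmat B ρ) * Q1 * Ω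
    + colsFrom Xi ρ 1 * IG B ρ * Q2 * Y
    + colsFrom Xi ρ 2 * IG B ρ * Q1 * Ω

/-- Entrywise `F(t) = O(t^c)` as `t → 0+`. -/
def IsOPow {m n : Type*} (F : ℝ → Matrix m n ℂ) (c : ℝ) : Prop :=
  ∀ i j, (fun t => F t i j) =O[𝓝[>] (0 : ℝ)] fun t => t ^ c

/-- The real fractional power `t^c`, as a complex number. -/
def tpow (t c : ℝ) : ℂ := ((t ^ c : ℝ) : ℂ)

end JordanPert

end

/-! Put `c = t^{1/ρ}`. Scale the coordinate at position `l` of each Jordan chain by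
`c^{min(l-1, ρ)}` and divide each row by a suitable power of `c`; the invariant subspace equation
`(A + c^ρ D) v = v (λ₀ + c X)` then becomes analytic in `c`. At `c = 0` it has an explicit solution
with `X = Ω`. Normalize the part of `v` in block `ρ` by the dual basis of `[Φ Φc]`. The
linearization at `c = 0` is then injective: the blocks shorter than `ρ` vanish because `Ω` is
invertible, block `ρ` satisfies a Sylvester equation for `Θ_ρ`, which has only the trivial solution
because the spectra of `Ω` and `Ωc` are disjoint, and the longer blocks are determined through
`W_{ρ+1}`. The implicit function theorem yields analytic `v(c)` and `X(c)`, and differentiating the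
equation at `c = 0` identifies `H₁` and `Δ₁₁`. Part 2 follows on substituting the expansions of
part 1. -/

noncomputable section

namespace JordanPert

section Invertible

variable {R ι κ : Type*} [CommRing R] [Fintype ι] [DecidableEq ι]

theorem eq_zero_of_isUnit_of_mul_eq_zero {M : Matrix ι ι R} (hM : IsUnit M) {X : Matrix ι κ R}
    (h : M * X = 0) : X = 0 := by
  rw [← nonsing_inv_mul_cancel_left M X ((isUnit_iff_isUnit_det M).1 hM), h, Matrix.mul_zero]

theorem eq_inv_mul_of_mul_eq {M : Matrix ι ι R} (hM : IsUnit M) {X Y : Matrix ι κ R}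
    (h : M * X = Y) : X = M⁻¹ * Y := by
  rw [← h, nonsing_inv_mul_cancel_left M X ((isUnit_iff_isUnit_det M).1 hM)]

theorem eq_mul_inv_of_mul_eq {M : Matrix ι ι R} (hM : IsUnit M) {X Y : Matrix κ ι R}
    (h : X * M = Y) : X = Y * M⁻¹ := by
  rw [← h, mul_nonsing_inv_cancel_right M X ((isUnit_iff_isUnit_det M).1 hM)]

end Invertible

section Field

variable {𝕜 m n : Type*} [Field 𝕜] [Fintype m] [DecidableEq m] [Fintype n] [DecidableEq n]

theorem isUnit_of_forall_mul_eq_zero {M : Matrix m m 𝕜}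
    (h : ∀ u : Matrix m Unit 𝕜, M * u = 0 → u = 0) : IsUnit M := by
  rw [← mulVec_injective_iff_isUnit]
  refine (injective_iff_map_eq_zero M.mulVecLin).2 fun u hu => ?_
  rw [mulVecLin_apply] at hu
  have hcol : replicateCol Unit u = 0 :=
    h _ (by rw [← replicateCol_mulVec, hu, replicateCol_zero])
  exact replicateCol_injective (hcol.trans replicateCol_zero.symm)

omit [DecidableEq m] in
theorem rank_eq_card_of_mul_eq_one {H : Matrix m n 𝕜} {L : Matrix n m 𝕜} (h : L * H = 1) :
    H.rank = Fintype.card n := by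
  refine le_antisymm H.rank_le_card_width ?_
  rw [← rank_one (R := 𝕜), ← h]
  exact rank_mul_le_right L H

theorem aeval_mul_of_mul_eq_mul {M : Matrix m m 𝕜} {N : Matrix n n 𝕜} {Y : Matrix m n 𝕜}
    (h : M * Y = Y * N) (p : Polynomial 𝕜) :
    Polynomial.aeval M p * Y = Y * Polynomial.aeval N p := by
  have hpow (e : ℕ) : M ^ e * Y = Y * N ^ e := by
    induction e with
    | zero => simp
    | succ e ih =>
      rw [pow_succ, pow_succ, Matrix.mul_assoc, h, ← Matrix.mul_assoc, ih, Matrix.mul_assoc]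
  induction p using Polynomial.induction_on' with
  | add p q hp hq => rw [map_add, map_add, Matrix.add_mul, Matrix.mul_add, hp, hq]
  | monomial e a =>
    simp only [Polynomial.aeval_monomial, Algebra.algebraMap_eq_smul_one, smul_mul_assoc, one_mul,
      Matrix.smul_mul, Matrix.mul_smul, hpow]

theorem eq_zero_of_disjoint_spectrum [IsAlgClosed 𝕜] {M : Matrix m m 𝕜} {N : Matrix n n 𝕜}
    {Y : Matrix m n 𝕜} (hd : Disjoint (spectrum 𝕜 M) (spectrum 𝕜 N)) (h : M * Y = Y * N) :
    Y = 0 := by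
  cases isEmpty_or_nonempty n with
  | inl hn => exact Matrix.ext fun _ j => hn.elim j
  | inr hn =>
    have hdeg : 0 < N.charpoly.degree := by
      rw [charpoly_degree_eq_dim]
      exact_mod_cast Fintype.card_pos
    have hunit : IsUnit (Polynomial.aeval M N.charpoly) := by
      rw [← spectrum.zero_notMem_iff 𝕜, spectrum.map_polynomial_aeval_of_degree_pos M _ hdeg]
      rintro ⟨μ, hμ, hr⟩
      exact Set.disjoint_left.1 hd hμ (mem_spectrum_iff_isRoot_charpoly.2 hr)
    -- Evaluating the intertwining relation at the characteristic polynomial of `N`.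
    refine eq_zero_of_isUnit_of_mul_eq_zero hunit ?_
    rw [aeval_mul_of_mul_eq_mul h, aeval_self_charpoly, Matrix.mul_zero]

end Field

/-- The columns of `[Φ Φc]` form a basis, with dual basis the rows of `[P; Pc]`, and span a pair of
complementary invariant subspaces of `T` on which `T` acts as `Ω` and `Ωc`, with disjoint
spectra. -/
structure IsSpectralSplitting {𝕜 ι m n : Type*} [Field 𝕜] [Fintype ι] [DecidableEq ι]
    [Fintype m] [DecidableEq m] [Fintype n] [DecidableEq n] (T : Matrix ι ι 𝕜)
    (Φ : Matrix ι m 𝕜) (Φc : Matrix ι n 𝕜) (Ω : Matrix m m 𝕜) (Ωc : Matrix n n 𝕜)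
    (P : Matrix m ι 𝕜) (Pc : Matrix n ι 𝕜) : Prop where
  mul_left : T * Φ = Φ * Ω
  mul_right : T * Φc = Φc * Ωc
  disjoint : Disjoint (spectrum 𝕜 Ω) (spectrum 𝕜 Ωc)
  sum_eq_one : Φ * P + Φc * Pc = 1
  dual_mul_left : P * Φ = 1
  dual_mul_right : P * Φc = 0
  dualc_mul_left : Pc * Φ = 0
  dualc_mul_right : Pc * Φc = 1

namespace IsSpectralSplitting

variable {𝕜 ι κ m n : Type*} [Field 𝕜] [Fintype ι] [DecidableEq ι]
  [Fintype m] [DecidableEq m] [Fintype n] [DecidableEq n] {T : Matrix ι ι 𝕜}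
  {Φ : Matrix ι m 𝕜} {Φc : Matrix ι n 𝕜} {Ω : Matrix m m 𝕜} {Ωc : Matrix n n 𝕜}
  {P : Matrix m ι 𝕜} {Pc : Matrix n ι 𝕜}

theorem of_fromCols (hΦ : T * Φ = Φ * Ω) (hΦc : T * Φc = Φc * Ωc)
    (hd : Disjoint (spectrum 𝕜 Ω) (spectrum 𝕜 Ωc)) {P : Matrix (m ⊕ n) ι 𝕜}
    (hl : P * fromCols Φ Φc = 1) (hr : fromCols Φ Φc * P = 1) :
    IsSpectralSplitting T Φ Φc Ω Ωc P.toRows₁ P.toRows₂ := by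
  rw [← fromRows_toRows P, fromRows_mul_fromCols, ← fromBlocks_one, fromBlocks_inj] at hl
  rw [← fromRows_toRows P, fromCols_mul_fromRows] at hr
  exact ⟨hΦ, hΦc, hd, hr, hl.1, hl.2.1, hl.2.2.1, hl.2.2.2⟩

variable (h : IsSpectralSplitting T Φ Φc Ω Ωc P Pc)
include h

theorem symm : IsSpectralSplitting T Φc Φ Ωc Ω Pc P :=
  ⟨h.mul_right, h.mul_left, h.disjoint.symm, (add_comm _ _).trans h.sum_eq_one,
    h.dualc_mul_right, h.dualc_mul_left, h.dual_mul_right, h.dual_mul_left⟩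

theorem dual_mul : P * T = Ω * P := by
  calc P * T = P * (T * (Φ * P + Φc * Pc)) := by rw [h.sum_eq_one, Matrix.mul_one]
    _ = P * Φ * Ω * P + P * Φc * Ωc * Pc := by
      simp only [Matrix.mul_add, ← Matrix.mul_assoc, h.mul_left, h.mul_right]
    _ = Ω * P := by
      rw [h.dual_mul_left, h.dual_mul_right, Matrix.one_mul, Matrix.zero_mul, Matrix.zero_mul,
        add_zero]

theorem isUnit (hT : IsUnit T) : IsUnit Ω := by
  refine isUnit_of_forall_mul_eq_zero fun u hu => ?_
  have hΦu : Φ * u = 0 := by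
    refine eq_zero_of_isUnit_of_mul_eq_zero hT ?_
    rw [← Matrix.mul_assoc, h.mul_left, Matrix.mul_assoc, hu, Matrix.mul_zero]
  rw [← Matrix.one_mul u, ← h.dual_mul_left, Matrix.mul_assoc, hΦu, Matrix.mul_zero]

theorem eq_mul_dualc {φ : Matrix ι κ 𝕜} (hφ : P * φ = 0) : φ = Φc * (Pc * φ) := by
  calc φ = (Φ * P + Φc * Pc) * φ := by rw [h.sum_eq_one, Matrix.one_mul]
    _ = Φc * (Pc * φ) := by
      rw [Matrix.add_mul, Matrix.mul_assoc, hφ, Matrix.mul_zero, zero_add, Matrix.mul_assoc]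

theorem eq_neg_dual_mul {φ R : Matrix ι m 𝕜} {X : Matrix m m 𝕜}
    (hR : T * φ - φ * Ω - Φ * X = R) (hφ : P * φ = 0) : X = -(P * R) := by
  rw [← hR, Matrix.mul_sub, Matrix.mul_sub, ← Matrix.mul_assoc, ← Matrix.mul_assoc,
    ← Matrix.mul_assoc, h.dual_mul, Matrix.mul_assoc, hφ, h.dual_mul_left]
  simp

theorem dualc_sylvester {φ R : Matrix ι m 𝕜} {X : Matrix m m 𝕜}
    (hR : T * φ - φ * Ω - Φ * X = R) : Ωc * (Pc * φ) - Pc * φ * Ω = Pc * R := by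
  rw [← hR, Matrix.mul_sub, Matrix.mul_sub, ← Matrix.mul_assoc, ← Matrix.mul_assoc,
    ← Matrix.mul_assoc, ← Matrix.mul_assoc, h.symm.dual_mul, h.dualc_mul_left, Matrix.zero_mul,
    sub_zero]

theorem eq_zero_of_sylvester [IsAlgClosed 𝕜] {φ : Matrix ι m 𝕜} {X : Matrix m m 𝕜}
    (hR : T * φ - φ * Ω - Φ * X = 0) (hφ : P * φ = 0) : φ = 0 ∧ X = 0 := by
  refine ⟨?_, by rw [h.eq_neg_dual_mul hR hφ, Matrix.mul_zero, neg_zero]⟩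
  have hc : Pc * φ = 0 := eq_zero_of_disjoint_spectrum h.disjoint.symm <| by
    rw [← sub_eq_zero, h.dualc_sylvester hR, Matrix.mul_zero]
  rw [h.eq_mul_dualc hφ, hc, Matrix.mul_zero]

end IsSpectralSplitting

section BlockCompanion

variable {R κ κ' m ν : Type*} {ρ : ℕ}

/-- The row block `l < ρ` (counted from `0`) of `φ`; it is zero if `l ≥ ρ`. -/
def prodBlk [Zero R] (φ : Matrix (Fin ρ × m) κ R) (l : ℕ) : Matrix m κ R :=
  Matrix.of fun y c => if h : l < ρ then φ (⟨l, h⟩, y) c else 0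

theorem prodBlk_apply [Zero R] (φ : Matrix (Fin ρ × m) κ R) (l : Fin ρ) (y : m) (c : κ) :
    prodBlk φ l y c = φ (l, y) c := by
  simp [prodBlk]

theorem prodBlk_ext [Zero R] {φ ψ : Matrix (Fin ρ × m) κ R}
    (h : ∀ l < ρ, prodBlk φ l = prodBlk ψ l) : φ = ψ := by
  ext ⟨l, y⟩ c
  rw [← prodBlk_apply φ, ← prodBlk_apply ψ, h l l.2]

theorem prodBlk_zero [Zero R] (l : ℕ) : prodBlk (0 : Matrix (Fin ρ × m) κ R) l = 0 := by
  ext y c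
  simp [prodBlk]

theorem prodBlk_sub [SubtractionMonoid R] (φ ψ : Matrix (Fin ρ × m) κ R) (l : ℕ) :
    prodBlk (φ - ψ) l = prodBlk φ l - prodBlk ψ l := by
  ext y c
  simp only [prodBlk, of_apply, Matrix.sub_apply]
  split_ifs <;> simp

theorem prodBlk_mul [NonUnitalNonAssocSemiring R] [Fintype κ] (φ : Matrix (Fin ρ × m) κ R)
    (X : Matrix κ κ' R) (l : ℕ) : prodBlk (φ * X) l = prodBlk φ l * X := by
  ext y c
  simp only [prodBlk, of_apply, Matrix.mul_apply]
  split_ifs <;> simp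

/-- The `ρ × ρ` block companion matrix, with identity blocks on the first block superdiagonal and
`S` in the lower left corner, so that `Theta B ρ` is the block companion matrix of `S B ρ`. -/
def blockCompanion [Zero R] [One R] [DecidableEq m] (ρ : ℕ) (S : Matrix m m R) :
    Matrix (Fin ρ × m) (Fin ρ × m) R :=
  Matrix.of fun p q =>
    if (q.1 : ℕ) = p.1 + 1 then (if p.2 = q.2 then 1 else 0)
    else if (p.1 : ℕ) + 1 = ρ ∧ (q.1 : ℕ) = 0 then S p.2 q.2
    else 0

/-- The block row `[Ω^{ρ-1} Q̃, …, Ω Q̃, Q̃]`. -/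
def leftRow [Semiring R] [Fintype ν] [DecidableEq ν] (ρ : ℕ) (Ω : Matrix ν ν R)
    (Qt : Matrix ν m R) : Matrix ν (Fin ρ × m) R :=
  Matrix.of fun i p => (Ω ^ (ρ - 1 - p.1) * Qt) i p.2

variable [CommRing R] [Fintype m] [DecidableEq m] [Fintype ν] [DecidableEq ν]

theorem prodBlk_blockCompanion_mul_of_lt (S : Matrix m m R) (φ : Matrix (Fin ρ × m) κ R) {l : ℕ}
    (hl : l + 1 < ρ) : prodBlk (blockCompanion ρ S * φ) l = prodBlk φ (l + 1) := by
  ext y c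
  have hl' : l < ρ := by omega
  simp only [prodBlk, of_apply, hl, hl', dite_true, Matrix.mul_apply]
  rw [Finset.sum_eq_single (⟨l + 1, hl⟩, y)]
  · simp [blockCompanion]
  · rintro ⟨j, z⟩ - hne
    have hlρ : l + 1 ≠ ρ := by omega
    by_cases hj : (j : ℕ) = l + 1
    · have hz : y ≠ z := by
        rintro rfl
        exact hne (Prod.ext (Fin.ext hj) rfl)
      simp [blockCompanion, hj, hz]
    · simp [blockCompanion, hj, hlρ]
  · simp

theorem prodBlk_blockCompanion_mul_last (S : Matrix m m R) (φ : Matrix (Fin ρ × m) κ R)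
    (hρ : 0 < ρ) : prodBlk (blockCompanion ρ S * φ) (ρ - 1) = S * prodBlk φ 0 := by
  ext y c
  have hl : ρ - 1 < ρ := by omega
  have hlρ : ρ - 1 + 1 = ρ := by omega
  simp only [prodBlk, of_apply, hρ, hl, dite_true, Matrix.mul_apply]
  rw [Fintype.sum_prod_type, Finset.sum_eq_single ⟨0, hρ⟩]
  · refine Finset.sum_congr rfl fun z _ => ?_
    simp [blockCompanion, hlρ, hρ.ne]
  · rintro j - hne
    have hj0 : (j : ℕ) ≠ 0 := fun h => hne (Fin.ext h)
    have hjρ : (j : ℕ) ≠ ρ - 1 + 1 := by have := j.2; omega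
    simp [blockCompanion, hj0, hjρ]
  · simp

theorem isUnit_blockCompanion {𝕜 : Type*} [Field 𝕜] {S : Matrix m m 𝕜} (hρ : 0 < ρ)
    (hS : IsUnit S) : IsUnit (blockCompanion ρ S) := by
  refine isUnit_of_forall_mul_eq_zero fun u hu => prodBlk_ext fun l hl => ?_
  rw [prodBlk_zero]
  rcases l with _ | l
  · refine eq_zero_of_isUnit_of_mul_eq_zero hS ?_
    rw [← prodBlk_blockCompanion_mul_last S u hρ, hu, prodBlk_zero]
  · rw [← prodBlk_blockCompanion_mul_of_lt S u hl, hu, prodBlk_zero]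

theorem prodBlk_of_blockCompanion_mul_eq {S : Matrix m m R} {Φ : Matrix (Fin ρ × m) ν R}
    {Ω : Matrix ν ν R} (hΦ : blockCompanion ρ S * Φ = Φ * Ω) {l : ℕ} (hl : l < ρ) :
    prodBlk Φ l = prodBlk Φ 0 * Ω ^ l := by
  induction l with
  | zero => simp
  | succ l ih =>
    rw [← prodBlk_blockCompanion_mul_of_lt S Φ hl, hΦ, prodBlk_mul, ih (by omega), pow_succ,
      Matrix.mul_assoc]

theorem mul_prodBlk_zero_of_blockCompanion_mul_eq {S : Matrix m m R} {Φ : Matrix (Fin ρ × m) ν R}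
    {Ω : Matrix ν ν R} (hρ : 0 < ρ) (hΦ : blockCompanion ρ S * Φ = Φ * Ω) :
    S * prodBlk Φ 0 = prodBlk Φ 0 * Ω ^ ρ := by
  rw [← prodBlk_blockCompanion_mul_last S Φ hρ, hΦ, prodBlk_mul,
    prodBlk_of_blockCompanion_mul_eq hΦ (by omega), Matrix.mul_assoc, ← pow_succ,
    Nat.sub_add_cancel hρ]

omit [DecidableEq m] in
theorem leftRow_mul (Ω : Matrix ν ν R) (Qt : Matrix ν m R) (φ : Matrix (Fin ρ × m) κ R) :
    leftRow ρ Ω Qt * φ = ∑ l ∈ Finset.range ρ, Ω ^ (ρ - 1 - l) * Qt * prodBlk φ l := by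
  ext i c
  rw [Matrix.mul_apply, Matrix.sum_apply, Fintype.sum_prod_type,
    ← Fin.sum_univ_eq_sum_range fun l => (Ω ^ (ρ - 1 - l) * Qt * prodBlk φ l) i c]
  refine Finset.sum_congr rfl fun l _ => ?_
  rw [Matrix.mul_apply]
  refine Finset.sum_congr rfl fun y _ => ?_
  rw [prodBlk_apply]
  rfl

theorem leftRow_mul_blockCompanion_mul {S : Matrix m m R} {Ω : Matrix ν ν R} {Qt : Matrix ν m R}
    (hρ : 0 < ρ) (hQt : Qt * S = Ω ^ ρ * Qt) (φ : Matrix (Fin ρ × m) κ R) :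
    leftRow ρ Ω Qt * (blockCompanion ρ S * φ) = Ω * (leftRow ρ Ω Qt * φ) := by
  obtain ⟨n, rfl⟩ : ∃ n, ρ = n + 1 := ⟨ρ - 1, by omega⟩
  rw [leftRow_mul, leftRow_mul, Finset.sum_range_succ, Finset.sum_range_succ', Matrix.mul_add,
    Matrix.mul_sum]
  congr 1
  · refine Finset.sum_congr rfl fun l hl => ?_
    have hl := Finset.mem_range.1 hl
    have hexp : n + 1 - 1 - l = n + 1 - 1 - (l + 1) + 1 := by omega
    rw [prodBlk_blockCompanion_mul_of_lt S φ (by omega), ← Matrix.mul_assoc, ← Matrix.mul_assoc,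
      ← pow_succ', hexp]
  · have hlast : prodBlk (blockCompanion (n + 1) S * φ) n = S * prodBlk φ 0 :=
      prodBlk_blockCompanion_mul_last S φ hρ
    rw [hlast, Nat.add_sub_cancel, Nat.sub_self, Nat.sub_zero, pow_zero, Matrix.one_mul,
      ← Matrix.mul_assoc, hQt, ← Matrix.mul_assoc, ← Matrix.mul_assoc, ← pow_succ']

variable {𝕜 ν' : Type*} [Field 𝕜] [Fintype ν'] [DecidableEq ν']
  {S : Matrix m m 𝕜} {Φ : Matrix (Fin ρ × m) ν 𝕜} {Φc : Matrix (Fin ρ × m) ν' 𝕜}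
  {Ω : Matrix ν ν 𝕜} {Ωc : Matrix ν' ν' 𝕜} {P : Matrix ν (Fin ρ × m) 𝕜}
  {Pc : Matrix ν' (Fin ρ × m) 𝕜}

theorem leftRow_eq_mul_dual [IsAlgClosed 𝕜]
    (h : IsSpectralSplitting (blockCompanion ρ S) Φ Φc Ω Ωc P Pc) (hρ : 0 < ρ)
    {Qt : Matrix ν m 𝕜} (hQt : Qt * S = Ω ^ ρ * Qt) :
    leftRow ρ Ω Qt = leftRow ρ Ω Qt * Φ * P := by
  -- `leftRow` intertwines `Ω` with the companion matrix, whose restriction to `Φc` has a spectrum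
  -- disjoint from that of `Ω`.
  have hc : leftRow ρ Ω Qt * Φc = 0 := eq_zero_of_disjoint_spectrum h.disjoint <| by
    rw [← leftRow_mul_blockCompanion_mul hρ hQt, h.mul_right, Matrix.mul_assoc]
  calc leftRow ρ Ω Qt = leftRow ρ Ω Qt * (Φ * P + Φc * Pc) := by rw [h.sum_eq_one, Matrix.mul_one]
    _ = leftRow ρ Ω Qt * Φ * P := by
      rw [Matrix.mul_add, ← Matrix.mul_assoc, ← Matrix.mul_assoc, hc, Matrix.zero_mul, add_zero]

theorem dual_mul_of_prodBlk_eq_zero [IsAlgClosed 𝕜]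
    (h : IsSpectralSplitting (blockCompanion ρ S) Φ Φc Ω Ωc P Pc) (hρ : 2 ≤ ρ)
    {Qt : Matrix ν m 𝕜} (hQt : Qt * S = Ω ^ ρ * Qt) (hM : IsUnit (leftRow ρ Ω Qt * Φ))
    {R : Matrix (Fin ρ × m) κ 𝕜} (hR : ∀ l, l + 2 < ρ → prodBlk R l = 0) :
    P * R = (leftRow ρ Ω Qt * Φ)⁻¹
      * (Ω * Qt * prodBlk R (ρ - 2) + Qt * prodBlk R (ρ - 1)) := by
  have hrow : leftRow ρ Ω Qt * R = Ω * Qt * prodBlk R (ρ - 2) + Qt * prodBlk R (ρ - 1) := by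
    obtain ⟨n, rfl⟩ : ∃ n, ρ = n + 2 := ⟨ρ - 2, by omega⟩
    rw [leftRow_mul, Finset.sum_range_succ, Finset.sum_range_succ,
      Finset.sum_eq_zero fun l hl => by
        rw [hR l (by have := Finset.mem_range.1 hl; omega), Matrix.mul_zero]]
    simp
  refine eq_inv_mul_of_mul_eq hM ?_
  rw [← hrow, ← Matrix.mul_assoc, ← leftRow_eq_mul_dual h (by omega) hQt]

theorem leftRow_mul_eq_Msum {m r : ℕ} {S : Matrix (Fin m) (Fin m) ℂ}
    {Φ : Matrix (Fin ρ × Fin m) (Fin r) ℂ} {Ω : Matrix (Fin r) (Fin r) ℂ}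
    (hΦ : blockCompanion ρ S * Φ = Φ * Ω) (Qt : Matrix (Fin r) (Fin m) ℂ) :
    leftRow ρ Ω Qt * Φ = Msum ρ Ω Qt (prodBlk Φ 0) := by
  rw [leftRow_mul, Msum]
  refine Finset.sum_congr rfl fun l hl => ?_
  rw [prodBlk_of_blockCompanion_mul_eq hΦ (Finset.mem_range.1 hl), ← Matrix.mul_assoc]

end BlockCompanion

section Calculus

theorem exists_analyticAt_implicit {E F : Type*} [NormedAddCommGroup E] [NormedSpace ℂ E]
    [FiniteDimensional ℂ E] [NormedAddCommGroup F] [NormedSpace ℂ F] [FiniteDimensional ℂ F]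
    (hdim : Module.finrank ℂ E = Module.finrank ℂ F) {f : ℂ × E → F} {z₀ : E}
    (hf : ContDiffAt ℂ (⊤ : WithTop ℕ∞) f (0, z₀))
    (hinj : ∀ w : E, HasDerivAt (fun c : ℂ => f (0, z₀ + c • w)) 0 0 → w = 0) :
    ∃ z : ℂ → E, AnalyticAt ℂ z 0 ∧ z 0 = z₀ ∧ ∀ᶠ c in 𝓝 0, f (c, z c) = f (0, z₀) := by
  have : CompleteSpace E := FiniteDimensional.complete ℂ E
  have hker : Function.Injective (fderiv ℂ f (0, z₀) ∘L .inr ℂ ℂ E) := by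
    refine (injective_iff_map_eq_zero _).2 fun w hw => hinj w ?_
    have hline : HasDerivAt (fun c : ℂ => ((0 : ℂ), z₀ + c • w)) ((0 : ℂ), w) 0 := by
      simpa using (hasDerivAt_const (0 : ℂ) (0 : ℂ)).prodMk
        (((hasDerivAt_id (0 : ℂ)).smul_const w).const_add z₀)
    have hd : HasFDerivAt f (fderiv ℂ f (0, z₀)) (0, z₀ + (0 : ℂ) • w) := by
      simpa using (hf.differentiableAt (by simp)).hasFDerivAt
    have hw' : fderiv ℂ f (0, z₀) (0, w) = 0 := by simpa using hw
    exact hw' ▸ HasFDerivAt.comp_hasDerivAt (0 : ℂ) hd hline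
  have hbij : (fderiv ℂ f (0, z₀) ∘L .inr ℂ ℂ E).IsInvertible :=
    ⟨(LinearEquiv.ofInjectiveOfFinrankEq
      (fderiv ℂ f (0, z₀) ∘L .inr ℂ ℂ E).toLinearMap hker hdim).toContinuousLinearEquiv,
      ContinuousLinearMap.ext fun _ => rfl⟩
  exact ⟨hf.implicitFunction (by simp) hbij,
    (hf.contDiffAt_implicitFunction (by simp) hbij).analyticAt,
    hf.implicitFunction_apply_self (by simp) hbij,
    hf.eventually_apply_implicitFunction (by simp) hbij⟩

theorem isBigO_sq_of_analyticAt {f : ℂ → ℂ} (hf : AnalyticAt ℂ f 0) {f₁ : ℂ}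
    (h₁ : HasDerivAt f f₁ 0) :
    (fun c => f c - (f 0 + c * f₁)) =O[𝓝 0] fun c => c ^ 2 := by
  obtain ⟨p, hp⟩ := hf
  have hp1 : p.coeff 1 = f₁ := hp.hasDerivAt.unique h₁
  have hp0 : p.coeff 0 = f 0 := by rw [FormalMultilinearSeries.coeff, ← hp.coeff_zero]
  have h := hp.isBigO_sub_partialSum_pow 2
  simp only [zero_add] at h
  refine (h.congr_left fun c => ?_).trans (IsBigO.of_bound 1 (by simp))
  simp [FormalMultilinearSeries.partialSum, Finset.sum_range_succ, hp0, hp1]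

/-- Entrywise differentiability at `0` of a matrix function (`Matrix` carries no global norm). -/
def HasDerivAtZero {m n : Type*} (F : ℂ → Matrix m n ℂ) (F' : Matrix m n ℂ) : Prop :=
  ∀ i j, HasDerivAt (fun c => F c i j) (F' i j) 0

/-- Entrywise analyticity at `0` of a matrix function. -/
def AnalyticAtZero {m n : Type*} (F : ℂ → Matrix m n ℂ) : Prop :=
  ∀ i j, AnalyticAt ℂ (fun c => F c i j) 0

section Matrix

variable {m n p : Type*} {F F₁ : ℂ → Matrix m n ℂ} {F' F₁' : Matrix m n ℂ}

theorem hasDerivAtZero_const (X : Matrix m n ℂ) : HasDerivAtZero (fun _ => X) 0 :=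
  fun i j => hasDerivAt_const (0 : ℂ) (X i j)

theorem hasDerivAtZero_add_smul (X Y : Matrix m n ℂ) : HasDerivAtZero (fun c => X + c • Y) Y :=
  fun i j => by simpa using ((hasDerivAt_id (0 : ℂ)).mul_const (Y i j)).const_add (X i j)

namespace HasDerivAtZero

theorem unique (h : HasDerivAtZero F F') (h₁ : HasDerivAtZero F F₁') : F' = F₁' :=
  Matrix.ext fun i j => (h i j).unique (h₁ i j)

theorem add (h : HasDerivAtZero F F') (h₁ : HasDerivAtZero F₁ F₁') :
    HasDerivAtZero (fun c => F c + F₁ c) (F' + F₁') := fun i j => (h i j).add (h₁ i j)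

theorem sub (h : HasDerivAtZero F F') (h₁ : HasDerivAtZero F₁ F₁') :
    HasDerivAtZero (fun c => F c - F₁ c) (F' - F₁') := fun i j => (h i j).sub (h₁ i j)

theorem mul [Fintype n] {G : ℂ → Matrix n p ℂ} {G' : Matrix n p ℂ}
    (h : HasDerivAtZero F F') (hG : HasDerivAtZero G G') :
    HasDerivAtZero (fun c => F c * G c) (F' * G 0 + F 0 * G') := by
  intro i j
  simp only [Matrix.mul_apply, Matrix.add_apply, ← Finset.sum_add_distrib]
  exact HasDerivAt.fun_sum fun l _ => (h i l).mul (hG l j)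

theorem const_mul [Fintype n] {G : ℂ → Matrix n p ℂ} {G' : Matrix n p ℂ} (X : Matrix m n ℂ)
    (hG : HasDerivAtZero G G') : HasDerivAtZero (fun c => X * G c) (X * G') := by
  simpa using (hasDerivAtZero_const X).mul hG

theorem congr (h : HasDerivAtZero F F') (h' : ∀ᶠ c in 𝓝 0, F₁ c = F c) : HasDerivAtZero F₁ F' :=
  fun i j => (h i j).congr_of_eventuallyEq (h'.mono fun c hc => by simp only [hc])

end HasDerivAtZero

theorem analyticAtZero_const (X : Matrix m n ℂ) : AnalyticAtZero (fun _ => X) :=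
  fun _ _ => analyticAt_const

theorem AnalyticAtZero.mul [Fintype n] {G : ℂ → Matrix n p ℂ}
    (h : AnalyticAtZero F) (hG : AnalyticAtZero G) : AnalyticAtZero (fun c => F c * G c) := by
  intro i j
  simp only [Matrix.mul_apply]
  exact Finset.analyticAt_fun_sum _ fun l _ => (h i l).mul (hG l j)

theorem AnalyticAtZero.exists_hasDerivAtZero (h : AnalyticAtZero F) :
    ∃ F' : Matrix m n ℂ, HasDerivAtZero F F' :=
  ⟨of fun i j => deriv (fun c => F c i j) 0, fun i j => (h i j).differentiableAt.hasDerivAt⟩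

end Matrix

section Scaling

variable {K : Type*} [DecidableEq K]

/-- The diagonal scaling matrix `diag(c^{f p})`. -/
def diagPow (f : K → ℕ) (c : ℂ) : Matrix K K ℂ :=
  diagonal fun p => c ^ f p

/-- The diagonal projection on the coordinates `p` with `f p = a`; the Taylor coefficients of
`diagPow f` at `0` are `levelProj f 0`, `levelProj f 1`, …. -/
def levelProj (f : K → ℕ) (a : ℕ) : Matrix K K ℂ :=
  diagonal fun p => if f p = a then 1 else 0

theorem diagPow_zero (f : K → ℕ) : diagPow f 0 = levelProj f 0 := by
  simp only [diagPow, levelProj, zero_pow_eq]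

theorem diagPow_inv_mul_diagPow [Fintype K] (f : K → ℕ) {c : ℂ} (hc : c ≠ 0) :
    diagPow f c⁻¹ * diagPow f c = 1 := by
  rw [diagPow, diagPow, diagonal_mul_diagonal, ← diagonal_one]
  congr 1
  ext p
  rw [← mul_pow, inv_mul_cancel₀ hc, one_pow]

theorem hasDerivAtZero_diagPow (f : K → ℕ) : HasDerivAtZero (diagPow f) (levelProj f 1) := by
  intro i j
  by_cases hij : i = j
  · subst hij
    simp only [diagPow, levelProj, diagonal_apply_eq]
    have hcoeff (a : ℕ) : (if a = 1 then 1 else 0 : ℂ) = a * 0 ^ (a - 1) := by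
      rcases a with _ | _ | a <;> simp
    rw [hcoeff]
    exact hasDerivAt_pow (f i) (0 : ℂ)
  · simp only [diagPow, levelProj, diagonal_apply_ne _ hij]
    exact hasDerivAt_const _ _

theorem analyticAtZero_diagPow (f : K → ℕ) : AnalyticAtZero (diagPow f) := by
  intro i j
  by_cases hij : i = j
  · subst hij
    simp only [diagPow, diagonal_apply_eq]
    fun_prop
  · simp only [diagPow, diagonal_apply_ne _ hij]
    exact analyticAt_const

end Scaling

section ScaledEquation

variable {K ν : Type*} [Fintype K] [DecidableEq K] [Fintype ν] (A D : Matrix K K ℂ)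
  (d g h : K → ℕ)

/-- The residual of the invariant subspace equation of a perturbed matrix after scaling: at row `p`
the perturbation enters with the factor `c ^ g p`, the matrix `X` of the restriction with the factor
`c ^ h p`, and the unknown `v` stands for `diagPow d c * v`. -/
def scaledResidual (c : ℂ) (v : Matrix K ν ℂ) (X : Matrix ν ν ℂ) : Matrix K ν ℂ :=
  A * v + diagPow g c * (D * (diagPow d c * v)) - diagPow h c * (v * X)

/-- The derivative of `scaledResidual A D d g h 0` at `(v₀, Ω)` in the direction `(x, X)`. -/
def linearizedResidual (v₀ : Matrix K ν ℂ) (Ω : Matrix ν ν ℂ) (x : Matrix K ν ℂ)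
    (X : Matrix ν ν ℂ) : Matrix K ν ℂ :=
  A * x + levelProj g 0 * (D * (levelProj d 0 * x)) - levelProj h 0 * (x * Ω + v₀ * X)

/-- Minus the partial derivative of `scaledResidual A D d g h` with respect to `c` at
`(0, v₀, Ω)`. -/
def residualForcing (v₀ : Matrix K ν ℂ) (Ω : Matrix ν ν ℂ) : Matrix K ν ℂ :=
  levelProj h 1 * (v₀ * Ω) - levelProj g 1 * (D * (levelProj d 0 * v₀))
    - levelProj g 0 * (D * (levelProj d 1 * v₀))

variable {A D d g h}

theorem scaledResidual_zero (v : Matrix K ν ℂ) (X : Matrix ν ν ℂ) :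
    scaledResidual A D d g h 0 v X = linearizedResidual A D d g h v X v 0 := by
  simp only [scaledResidual, linearizedResidual, diagPow_zero, Matrix.mul_zero, add_zero]

theorem HasDerivAtZero.scaledResidual_zero {v : ℂ → Matrix K ν ℂ} {X : ℂ → Matrix ν ν ℂ}
    {v₁ : Matrix K ν ℂ} {X₁ : Matrix ν ν ℂ} (hv : HasDerivAtZero v v₁)
    (hX : HasDerivAtZero X X₁) :
    HasDerivAtZero (fun c => scaledResidual A D d g h 0 (v c) (X c))
      (linearizedResidual A D d g h (v 0) (X 0) v₁ X₁) := by
  simpa only [scaledResidual, linearizedResidual, diagPow_zero] using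
    ((hv.const_mul A).add (((hv.const_mul _).const_mul D).const_mul _)).sub
      ((hv.mul hX).const_mul _)

theorem HasDerivAtZero.scaledResidual {v : ℂ → Matrix K ν ℂ} {X : ℂ → Matrix ν ν ℂ}
    {v₁ : Matrix K ν ℂ} {X₁ : Matrix ν ν ℂ} (hv : HasDerivAtZero v v₁)
    (hX : HasDerivAtZero X X₁) :
    HasDerivAtZero (fun c => scaledResidual A D d g h c (v c) (X c))
      (linearizedResidual A D d g h (v 0) (X 0) v₁ X₁
        - residualForcing D d g h (v 0) (X 0)) := by
  have hderiv := ((hv.const_mul A).add ((hasDerivAtZero_diagPow g).mul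
    (((hasDerivAtZero_diagPow d).mul hv).const_mul D))).sub
      ((hasDerivAtZero_diagPow h).mul (hv.mul hX))
  refine fun i j => (hderiv i j).congr_deriv (congrFun (congrFun ?_ i) j)
  simp only [linearizedResidual, residualForcing, diagPow_zero, Matrix.mul_add]
  abel

theorem contDiff_scaledResidual : ContDiff ℂ (⊤ : WithTop ℕ∞)
    fun p : ℂ × (K → ν → ℂ) × (ν → ν → ℂ) =>
      of.symm (scaledResidual A D d g h p.1 (of p.2.1) (of p.2.2)) := by
  refine contDiff_pi.2 fun i => contDiff_pi.2 fun j => ?_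
  simp only [scaledResidual, diagPow, of_symm_apply, Matrix.add_apply, Matrix.sub_apply,
    diagonal_mul, Matrix.mul_apply (M := A), Matrix.mul_apply (M := D)]
  simp only [Matrix.mul_apply, of_apply]
  fun_prop

theorem exists_analytic_solution {L : Matrix ν K ℂ} {v₀ : Matrix K ν ℂ} {Ω : Matrix ν ν ℂ}
    (h₀ : linearizedResidual A D d g h v₀ Ω v₀ 0 = 0)
    (hinj : ∀ x X, linearizedResidual A D d g h v₀ Ω x X = 0 → L * x = 0 → x = 0 ∧ X = 0) :
    ∃ (v : ℂ → Matrix K ν ℂ) (X : ℂ → Matrix ν ν ℂ), AnalyticAtZero v ∧ AnalyticAtZero X ∧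
      v 0 = v₀ ∧ X 0 = Ω ∧
      ∀ᶠ c in 𝓝 0, scaledResidual A D d g h c (v c) (X c) = 0 ∧ L * v c = L * v₀ := by
  let f : ℂ × (K → ν → ℂ) × (ν → ν → ℂ) → (K → ν → ℂ) × (ν → ν → ℂ) := fun p =>
    (of.symm (scaledResidual A D d g h p.1 (of p.2.1) (of p.2.2)), of.symm (L * of p.2.1))
  have hnorm : ContDiff ℂ (⊤ : WithTop ℕ∞)
      fun p : ℂ × (K → ν → ℂ) × (ν → ν → ℂ) => of.symm (L * of p.2.1) := by
    refine contDiff_pi.2 fun i => contDiff_pi.2 fun j => ?_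
    simp only [of_symm_apply, Matrix.mul_apply, of_apply]
    fun_prop
  have hf : ContDiff ℂ (⊤ : WithTop ℕ∞) f := contDiff_scaledResidual.prodMk hnorm
  have hker (w : (K → ν → ℂ) × (ν → ν → ℂ))
      (hw : HasDerivAt (fun c : ℂ => f (0, (of.symm v₀, of.symm Ω) + c • w)) 0 0) : w = 0 := by
    have hv := hasDerivAtZero_add_smul v₀ (of w.1)
    have hX := hasDerivAtZero_add_smul Ω (of w.2)
    have hres := HasDerivAtZero.unique (hv.scaledResidual_zero (A := A) (D := D) (d := d) (g := g)
      (h := h) hX) fun i j => hasDerivAt_pi.1 (hasDerivAt_pi.1 hw.fst i) j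
    have hL := HasDerivAtZero.unique (hv.const_mul L)
      fun i j => hasDerivAt_pi.1 (hasDerivAt_pi.1 hw.snd i) j
    simp only [zero_smul, add_zero] at hres
    obtain ⟨hx, hX0⟩ := hinj _ _ hres hL
    exact Prod.ext hx hX0
  obtain ⟨z, hz, hz0, hze⟩ := exists_analyticAt_implicit rfl hf.contDiffAt hker
  refine ⟨fun c => of (z c).1, fun c => of (z c).2,
    fun i j => analyticAt_pi_iff.1 (analyticAt_pi_iff.1 (analyticAt_fst.comp hz) i) j,
    fun i j => analyticAt_pi_iff.1 (analyticAt_pi_iff.1 (analyticAt_snd.comp hz) i) j,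
    congrArg Prod.fst hz0, congrArg Prod.snd hz0, hze.mono fun c hc => ?_⟩
  exact ⟨(congrArg Prod.fst hc).trans ((scaledResidual_zero v₀ Ω).trans h₀),
    congrArg Prod.snd hc⟩

theorem linearizedResidual_eq_residualForcing {L : Matrix ν K ℂ} {E : Matrix ν ν ℂ}
    {v : ℂ → Matrix K ν ℂ} {X : ℂ → Matrix ν ν ℂ} {v₁ : Matrix K ν ℂ} {X₁ : Matrix ν ν ℂ}
    (hv : HasDerivAtZero v v₁) (hX : HasDerivAtZero X X₁)
    (hsol : ∀ᶠ c in 𝓝 0, scaledResidual A D d g h c (v c) (X c) = 0 ∧ L * v c = E) :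
    linearizedResidual A D d g h (v 0) (X 0) v₁ X₁ = residualForcing D d g h (v 0) (X 0) ∧
      L * v₁ = 0 :=
  ⟨sub_eq_zero.1 ((hv.scaledResidual hX).unique
      ((hasDerivAtZero_const 0).congr (hsol.mono fun _ hc => hc.1))),
    (hv.const_mul L).unique ((hasDerivAtZero_const E).congr (hsol.mono fun _ hc => hc.2))⟩

/-- `e` is the exponent by which a row of the unscaled equation has been divided. -/
theorem mul_diagPow_mul_of_scaledResidual_eq_zero {e : K → ℕ} {ρ : ℕ} {c : ℂ} {v : Matrix K ν ℂ}
    {X : Matrix ν ν ℂ} (hA : diagPow e c * A = A * diagPow d c) (hg : ∀ p, e p + g p = ρ)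
    (hh : ∀ p, e p + h p = d p + 1) (hres : scaledResidual A D d g h c v X = 0) :
    (A + c ^ ρ • D) * (diagPow d c * v) = diagPow d c * v * (c • X) := by
  have hg' : diagPow e c * diagPow g c = c ^ ρ • 1 := by
    simp only [diagPow, diagonal_mul_diagonal, ← pow_add, hg, smul_one_eq_diagonal]
  have hh' : diagPow e c * diagPow h c = c • diagPow d c := by
    simp only [diagPow, diagonal_mul_diagonal, ← pow_add, hh, pow_succ', ← diagonal_smul]
    rfl
  have hscaled := congrArg (diagPow e c * ·) hres
  simp only [scaledResidual, Matrix.mul_sub, Matrix.mul_add, ← Matrix.mul_assoc, hA, hg', hh',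
    Matrix.smul_mul, Matrix.one_mul, Matrix.mul_zero, sub_eq_zero] at hscaled
  simp only [Matrix.add_mul, Matrix.smul_mul, Matrix.mul_smul, ← Matrix.mul_assoc, hscaled]

end ScaledEquation

end Calculus

section Blocks

variable {k : ℕ} {s : ℕ → ℕ} {ι κ κ' : Type*}

/-- The sub-block `x_{il}` of the rows of `x`; like `colBlk`, it is zero when void. -/
def rowBlk (x : Matrix (JIdx k s) κ ℂ) (i l : ℕ) : Matrix (Fin (s i)) κ ℂ :=
  (colBlk xᵀ i l)ᵀ

/-- The block column with blocks `x_{il}, x_{i+1,l}, …, x_{kl}`. -/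
def rowsFrom (x : Matrix (JIdx k s) κ ℂ) (i l : ℕ) : Matrix (TIdx i k s) κ ℂ :=
  (colsFrom xᵀ i l)ᵀ

/-- The block `j` of a block column with blocks `a, …, k`; it is zero when void. -/
def tBlk {a : ℕ} (T : Matrix (TIdx a k s) κ ℂ) (j : ℕ) : Matrix (Fin (s j)) κ ℂ :=
  Matrix.of fun y c => if h : a ≤ j ∧ j ≤ k then T ⟨⟨j, h⟩, y⟩ c else 0

/-- The position `l` of the coordinate `(i, l, x)` in its Jordan chain. -/
def jordanLevel (k : ℕ) (s : ℕ → ℕ) (p : JIdx k s) : ℕ :=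
  p.2.1

theorem rowBlk_apply (x : Matrix (JIdx k s) κ ℂ) {i l : ℕ} (hi : i ∈ Set.Icc 1 k)
    (hl : l ∈ Set.Icc 1 i) (y : Fin (s i)) (c : κ) :
    rowBlk x i l y c = x ⟨⟨i, hi⟩, ⟨l, hl⟩, y⟩ c := by
  have h : (1 ≤ i ∧ i ≤ k) ∧ (1 ≤ l ∧ l ≤ i) := ⟨hi, hl⟩
  simp [rowBlk, colBlk, h]

theorem colBlk_apply (Xi : Matrix ι (JIdx k s) ℂ) {i l : ℕ} (hi : i ∈ Set.Icc 1 k)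
    (hl : l ∈ Set.Icc 1 i) (y : Fin (s i)) (c : ι) :
    colBlk Xi i l c y = Xi c ⟨⟨i, hi⟩, ⟨l, hl⟩, y⟩ :=
  rowBlk_apply Xiᵀ hi hl y c

theorem rowBlk_void (x : Matrix (JIdx k s) κ ℂ) {i l : ℕ}
    (h : ¬((1 ≤ i ∧ i ≤ k) ∧ (1 ≤ l ∧ l ≤ i))) : rowBlk x i l = 0 := by
  ext y c
  simp only [rowBlk, colBlk, transpose_apply, of_apply, dif_neg h, Matrix.zero_apply]

theorem rowBlk_ext {x y : Matrix (JIdx k s) κ ℂ}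
    (h : ∀ i l, 1 ≤ i → i ≤ k → 1 ≤ l → l ≤ i → rowBlk x i l = rowBlk y i l) : x = y := by
  ext ⟨⟨i, hi⟩, ⟨l, hl⟩, a⟩ c
  rw [← rowBlk_apply x hi hl, ← rowBlk_apply y hi hl, h i l hi.1 hi.2 hl.1 hl.2]

theorem rowBlk_zero (i l : ℕ) : rowBlk (0 : Matrix (JIdx k s) κ ℂ) i l = 0 := by
  ext a c
  simp [rowBlk, colBlk]

theorem rowBlk_add (x y : Matrix (JIdx k s) κ ℂ) (i l : ℕ) :
    rowBlk (x + y) i l = rowBlk x i l + rowBlk y i l := by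
  ext a c
  simp only [rowBlk, colBlk, transpose_apply, of_apply, Matrix.add_apply]
  split_ifs <;> simp

theorem rowBlk_sub (x y : Matrix (JIdx k s) κ ℂ) (i l : ℕ) :
    rowBlk (x - y) i l = rowBlk x i l - rowBlk y i l := by
  ext a c
  simp only [rowBlk, colBlk, transpose_apply, of_apply, Matrix.sub_apply]
  split_ifs <;> simp

theorem rowBlk_mul [Fintype κ] (x : Matrix (JIdx k s) κ ℂ) (y : Matrix κ κ' ℂ) (i l : ℕ) :
    rowBlk (x * y) i l = rowBlk x i l * y := by
  ext a c
  simp only [rowBlk, colBlk, transpose_apply, of_apply, Matrix.mul_apply]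
  split_ifs <;> simp

theorem rowBlk_levelProj_mul (f : ℕ → ℕ) (a : ℕ) (x : Matrix (JIdx k s) κ ℂ) (i l : ℕ) :
    rowBlk (levelProj (f ∘ jordanLevel k s) a * x) i l = if f l = a then rowBlk x i l else 0 := by
  ext y c
  simp only [rowBlk, colBlk, transpose_apply, of_apply, levelProj, diagonal_mul, jordanLevel,
    Function.comp_apply]
  split_ifs <;> simp_all

theorem rowBlk_jordanN_mul (x : Matrix (JIdx k s) κ ℂ) (i : ℕ) {l : ℕ} (hl : 1 ≤ l) :
    rowBlk (jordanN k s * x) i l = rowBlk x i (l + 1) := by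
  by_cases h : (1 ≤ i ∧ i ≤ k) ∧ (1 ≤ l ∧ l ≤ i)
  swap
  · rw [rowBlk_void _ h, rowBlk_void _ (by omega)]
  ext y c
  have hi : i ∈ Set.Icc 1 k := h.1
  have hl' : l ∈ Set.Icc 1 i := h.2
  rw [rowBlk_apply _ hi hl', Matrix.mul_apply]
  by_cases h' : l + 1 ≤ i
  · have hl₁ : l + 1 ∈ Set.Icc 1 i := ⟨by omega, h'⟩
    rw [rowBlk_apply _ hi hl₁, Finset.sum_eq_single ⟨⟨i, hi⟩, ⟨l + 1, hl₁⟩, y⟩]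
    · simp [jordanN]
    · rintro ⟨⟨j, hj⟩, ⟨m, hm⟩, z⟩ - hne
      simp only [jordanN, of_apply]
      rw [if_neg, zero_mul]
      rintro ⟨hij : i = j, hml : m = l + 1, hyz⟩
      apply hne
      subst hij hml
      simp [Fin.ext_iff, hyz]
    · simp
  · rw [rowBlk_void _ (by omega)]
    refine Finset.sum_eq_zero ?_
    rintro ⟨⟨j, hj⟩, ⟨m, hm⟩, z⟩ -
    simp only [jordanN, of_apply]
    rw [if_neg, zero_mul]
    rintro ⟨hij : i = j, hml : m = l + 1, -⟩
    have hmj : m ≤ j := hm.2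
    omega

theorem tBlk_apply {a : ℕ} (T : Matrix (TIdx a k s) κ ℂ) (p : TIdx a k s) (c : κ) :
    tBlk T p.1 p.2 c = T p c := by
  have h : a ≤ (p.1 : ℕ) ∧ (p.1 : ℕ) ≤ k := p.1.2
  simp [tBlk, h]

theorem tBlk_ext {a : ℕ} {T U : Matrix (TIdx a k s) κ ℂ}
    (h : ∀ j, a ≤ j → j ≤ k → tBlk T j = tBlk U j) : T = U := by
  ext p c
  rw [← tBlk_apply T, ← tBlk_apply U, h p.1 p.1.2.1 p.1.2.2]

theorem tBlk_zero {a : ℕ} (j : ℕ) : tBlk (0 : Matrix (TIdx a k s) κ ℂ) j = 0 := by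
  ext y c
  simp [tBlk]

theorem tBlk_add {a : ℕ} (T U : Matrix (TIdx a k s) κ ℂ) (j : ℕ) :
    tBlk (T + U) j = tBlk T j + tBlk U j := by
  ext y c
  simp only [tBlk, of_apply, Matrix.add_apply]
  split_ifs <;> simp

theorem tBlk_mul [Fintype κ] {a : ℕ} (T : Matrix (TIdx a k s) κ ℂ) (U : Matrix κ κ' ℂ) (j : ℕ) :
    tBlk (T * U) j = tBlk T j * U := by
  ext y c
  simp only [tBlk, of_apply, Matrix.mul_apply]
  split_ifs <;> simp

theorem tBlk_rowsFrom (x : Matrix (JIdx k s) κ ℂ) {a j : ℕ} (m : ℕ) (h : a ≤ j) :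
    tBlk (rowsFrom x a m) j = rowBlk x j m := by
  ext y c
  by_cases h' : j ≤ k
  · simp [tBlk, rowsFrom, colsFrom, rowBlk, h, h']
  · rw [rowBlk_void _ (by omega)]
    simp [tBlk, h']

theorem tBlk_stack_self {a i b : ℕ} (X : Matrix (Fin (s i)) κ ℂ) (Y : Matrix (TIdx b k s) κ ℂ)
    (ha : a ≤ i) (hk : i ≤ k) : tBlk (stack a i b X Y) i = X := by
  ext y c
  simp [tBlk, stack, ha, hk]

theorem tBlk_stack_of_ge {a i b j : ℕ} (X : Matrix (Fin (s i)) κ ℂ)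
    (Y : Matrix (TIdx b k s) κ ℂ) (ha : a ≤ i) (hb : i < b) (hj : b ≤ j) :
    tBlk (stack a i b X Y) j = tBlk Y j := by
  ext y c
  have haj : a ≤ j := by omega
  have hij : j ≠ i := by omega
  by_cases hk : j ≤ k <;> simp [tBlk, stack, haj, hij, hk, hj]

theorem tBlk_stack_of_lt {a i b j : ℕ} (X : Matrix (Fin (s i)) κ ℂ)
    (Y : Matrix (TIdx b k s) κ ℂ) (hi : j ≠ i) (hj : j < b) :
    tBlk (stack a i b X Y) j = 0 := by
  ext y c
  simp [tBlk, stack, hj.not_ge, hi]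

theorem sum_tIdx {M : Type*} [AddCommMonoid M] (a : ℕ) (f : (j : ℕ) → Fin (s j) → M) :
    ∑ p : TIdx a k s, f p.1 p.2 = ∑ j ∈ Finset.Icc a k, ∑ y, f j y := by
  rw [Fintype.sum_sigma, ← Finset.sum_coe_sort (Finset.Icc a k)]
  refine Fintype.sum_equiv (Equiv.subtypeEquivRight (by simp)) _ _ ?_
  rintro ⟨j, hj⟩
  rfl

theorem colsFrom_mul (Xi : Matrix ι (JIdx k s) ℂ) (a m : ℕ) (T : Matrix (TIdx a k s) κ ℂ) :
    colsFrom Xi a m * T = ∑ j ∈ Finset.Icc a k, colBlk Xi j m * tBlk T j := by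
  ext u c
  rw [Matrix.mul_apply, Matrix.sum_apply]
  simp only [Matrix.mul_apply]
  rw [← sum_tIdx a fun j y => colBlk Xi j m u y * tBlk T j y c]
  refine Finset.sum_congr rfl fun p _ => ?_
  rw [tBlk_apply]
  rfl

theorem mul_levelProj_mul (Xi : Matrix ι (JIdx k s) ℂ) (x : Matrix (JIdx k s) κ ℂ) (m : ℕ) :
    Xi * (levelProj (jordanLevel k s) m * x)
      = ∑ j ∈ Finset.Icc 1 k, colBlk Xi j m * rowBlk x j m := by
  ext u c
  rw [Matrix.mul_apply, Matrix.sum_apply]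
  simp only [Matrix.mul_apply (M := colBlk _ _ _)]
  rw [← sum_tIdx 1 fun j y => colBlk Xi j m u y * rowBlk x j m y c, Fintype.sum_sigma,
    Fintype.sum_sigma]
  refine Finset.sum_congr rfl fun ⟨j, hj⟩ _ => ?_
  rw [Fintype.sum_prod_type, Finset.sum_comm]
  refine Finset.sum_congr rfl fun y _ => ?_
  simp only [levelProj, jordanLevel, diagonal_mul]
  by_cases hm : m ∈ Set.Icc 1 j
  · rw [Finset.sum_eq_single ⟨m, hm⟩]
    · rw [colBlk_apply Xi hj hm, rowBlk_apply x hj hm]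
      simp
    · rintro ⟨l, hl⟩ - hne
      have hlm : l ≠ m := fun h => hne (Subtype.ext h)
      simp [hlm]
    · simp
  · rw [rowBlk_void x fun h => hm h.2]
    simp only [Matrix.zero_apply, mul_zero]
    refine Finset.sum_eq_zero fun l _ => ?_
    have hlm : (l : ℕ) ≠ m := fun h => hm (h ▸ l.2)
    simp [hlm]

theorem colsFrom_mul_stack (Xi : Matrix ι (JIdx k s) ℂ) (m : ℕ) {a i b : ℕ}
    (X : Matrix (Fin (s i)) κ ℂ) (Y : Matrix (TIdx b k s) κ ℂ) (ha : a ≤ i) (hb : i < b)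
    (hk : i ≤ k) :
    colsFrom Xi a m * stack a i b X Y = colBlk Xi i m * X + colsFrom Xi b m * Y := by
  rw [colsFrom_mul, colsFrom_mul, ← Finset.add_sum_erase (a := i) _ _ (by simp; omega),
    tBlk_stack_self X Y ha hk]
  congr 1
  symm
  refine Finset.sum_subset_zero_on_sdiff ?_ ?_ ?_
  · intro j hj
    simp only [Finset.mem_erase, Finset.mem_Icc] at hj ⊢
    omega
  · intro j hj
    simp only [Finset.mem_sdiff, Finset.mem_erase, Finset.mem_Icc] at hj
    rw [tBlk_stack_of_lt _ _ hj.1.1 (by omega), Matrix.mul_zero]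
  · intro j hj
    simp only [Finset.mem_Icc] at hj
    rw [tBlk_stack_of_ge _ _ ha hb hj.1]

theorem mul_levelProj_mul_of_rowBlk_eq_zero {ρ : ℕ} (hρ : 2 ≤ ρ) (hρk : ρ ≤ k)
    (Xi : Matrix ι (JIdx k s) ℂ) (x : Matrix (JIdx k s) κ ℂ) (m : ℕ)
    (h : ∀ j < ρ - 1, rowBlk x j m = 0) :
    Xi * (levelProj (jordanLevel k s) m * x) = colBlk Xi (ρ - 1) m * rowBlk x (ρ - 1) m
      + colBlk Xi ρ m * rowBlk x ρ m + colsFrom Xi (ρ + 1) m * rowsFrom x (ρ + 1) m := by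
  rw [mul_levelProj_mul, colsFrom_mul, ← Finset.add_sum_erase (a := ρ - 1) _ _ (by simp; omega),
    ← Finset.add_sum_erase (a := ρ) _ _ (by simp; omega), add_assoc]
  congr 2
  symm
  refine Finset.sum_subset_zero_on_sdiff ?_ ?_ ?_
  · intro j hj
    simp only [Finset.mem_erase, Finset.mem_Icc] at hj ⊢
    omega
  · intro j hj
    simp only [Finset.mem_sdiff, Finset.mem_erase, Finset.mem_Icc] at hj
    rw [h j (by omega), Matrix.mul_zero]
  · intro j hj
    rw [tBlk_rowsFrom _ _ (Finset.mem_Icc.1 hj).1]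

theorem rowBlk_colBlk (B : Matrix (JIdx k s) (JIdx k s) ℂ) (i j l m : ℕ) :
    rowBlk (colBlk B j m) i l = blk B i j l m := rfl

theorem rowBlk_colsFrom (B : Matrix (JIdx k s) (JIdx k s) ℂ) (i j l m : ℕ) :
    rowBlk (colsFrom B j m) i l = blkRow B i j l m := rfl

theorem blkRow_mul_stack (B : Matrix (JIdx k s) (JIdx k s) ℂ) (i₀ l m : ℕ) {a i b : ℕ}
    (X : Matrix (Fin (s i)) κ ℂ) (Y : Matrix (TIdx b k s) κ ℂ) (ha : a ≤ i) (hb : i < b)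
    (hk : i ≤ k) :
    blkRow B i₀ a l m * stack a i b X Y = blk B i₀ i l m * X + blkRow B i₀ b l m * Y := by
  rw [← rowBlk_colsFrom, ← rowBlk_mul, colsFrom_mul_stack B m X Y ha hb hk, rowBlk_add,
    rowBlk_mul, rowBlk_mul, rowBlk_colBlk, rowBlk_colsFrom]

theorem rowBlk_mul_levelProj_mul_of_rowBlk_eq_zero {ρ : ℕ} (hρ : 2 ≤ ρ) (hρk : ρ ≤ k)
    (B : Matrix (JIdx k s) (JIdx k s) ℂ) (x : Matrix (JIdx k s) κ ℂ) (m : ℕ)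
    (h : ∀ j < ρ - 1, rowBlk x j m = 0) (i l : ℕ) :
    rowBlk (B * (levelProj (jordanLevel k s) m * x)) i l
      = blk B i (ρ - 1) l m * rowBlk x (ρ - 1) m + blk B i ρ l m * rowBlk x ρ m
        + blkRow B i (ρ + 1) l m * rowsFrom x (ρ + 1) m := by
  rw [mul_levelProj_mul_of_rowBlk_eq_zero hρ hρk B x m h, rowBlk_add, rowBlk_add, rowBlk_mul,
    rowBlk_mul, rowBlk_mul, rowBlk_colBlk, rowBlk_colBlk, rowBlk_colsFrom]

theorem tBlk_W_mul (B : Matrix (JIdx k s) (JIdx k s) ℂ) {i j : ℕ} (T : Matrix (TIdx i k s) κ ℂ)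
    (hij : i ≤ j) (hjk : j ≤ k) : tBlk (W B i * T) j = blkRow B j i j 1 * T := by
  ext y c
  exact tBlk_apply (W B i * T) ⟨⟨j, hij, hjk⟩, y⟩ c

theorem tBlk_Z (B : Matrix (JIdx k s) (JIdx k s) ℂ) {a i j : ℕ} (haj : a ≤ j) (hjk : j ≤ k) :
    tBlk (Z B a i) j = blk B j i j 1 := by
  ext y c
  exact tBlk_apply (Z B a i) ⟨⟨j, haj, hjk⟩, y⟩ c

end Blocks

section SchurComplement

variable {k : ℕ} {s : ℕ → ℕ} {B : Matrix (JIdx k s) (JIdx k s) ℂ} {ρ : ℕ}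

theorem Z_add_W_mul_G (hW : IsUnit (W B (ρ + 1))) (j : ℕ) :
    Z B (ρ + 1) j + W B (ρ + 1) * G B ρ j = 0 := by
  rw [G, Matrix.mul_neg, mul_nonsing_inv_cancel_left _ _ ((isUnit_iff_isUnit_det _).1 hW),
    add_neg_cancel]

theorem tBlk_IG_self (hρk : ρ ≤ k) : tBlk (IG B ρ) ρ = 1 :=
  tBlk_stack_self _ _ le_rfl hρk

theorem tBlk_IG_of_lt {i : ℕ} (hi : i < ρ) : tBlk (IG B ρ) i = 0 :=
  tBlk_stack_of_lt _ _ hi.ne (by omega)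

theorem tBlk_IG_of_gt {i : ℕ} (hi : ρ < i) : tBlk (IG B ρ) i = tBlk (G B ρ ρ) i :=
  tBlk_stack_of_ge _ _ le_rfl ρ.lt_succ_self hi

theorem blkRow_mul_IG (hρk : ρ ≤ k) (i l : ℕ) : blkRow B i ρ l 1 * IG B ρ = Bhat B ρ i l := by
  rw [IG, blkRow_mul_stack B i l 1 _ _ le_rfl ρ.lt_succ_self hρk, Matrix.mul_one, Bhat]

theorem Bhat_diag_eq_zero (hW : IsUnit (W B (ρ + 1))) {i : ℕ} (hi : ρ < i) (hik : i ≤ k) :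
    Bhat B ρ i i = 0 := by
  rw [Bhat, ← tBlk_Z B hi hik, ← tBlk_W_mul B _ hi hik, ← tBlk_add, Z_add_W_mul_G hW, tBlk_zero]

theorem isUnit_S (hρk : ρ ≤ k) (hW : IsUnit (W B ρ)) (hW' : IsUnit (W B (ρ + 1))) :
    IsUnit (S B ρ) := by
  refine isUnit_of_forall_mul_eq_zero fun u hu => ?_
  -- The columns of `[I; G]` are mapped by `W_ρ` to those of `[S; 0; …; 0]`.
  have hWu : W B ρ * (IG B ρ * u) = 0 := by
    refine tBlk_ext fun j hj hjk => ?_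
    rw [tBlk_W_mul B _ hj hjk, ← Matrix.mul_assoc, blkRow_mul_IG hρk, tBlk_zero]
    obtain rfl | hlt := eq_or_lt_of_le hj
    · exact hu
    · rw [Bhat_diag_eq_zero hW' hlt hjk, Matrix.zero_mul]
  rw [← Matrix.one_mul u, ← tBlk_IG_self (B := B) hρk, ← tBlk_mul,
    eq_zero_of_isUnit_of_mul_eq_zero hW hWu, tBlk_zero]

end SchurComplement

section LimitEquation

variable {k : ℕ} {s : ℕ → ℕ} {κ : Type*} [Fintype κ]

/-- The exponent `d` of the factor `c ^ d`, with `c = t ^ (1 / ρ)`, that scales the coordinates of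
the invariant subspace at level `l`. Level `0` stands for the coordinates that complete the Jordan
chains to a basis. -/
def scaleExp (ρ l : ℕ) : ℕ :=
  min (l - 1) ρ

/-- The exponent of the factor of the perturbation at level `l`, once the row of the equation at
that level has been divided by `c ^ min l ρ`. -/
def perturbExp (ρ l : ℕ) : ℕ :=
  ρ - l

/-- The exponent of the factor of the restriction matrix at level `l`, once the row of the equation
at that level has been divided by `c ^ min l ρ`: `0` if `1 ≤ l ≤ ρ`, and `1` otherwise. -/
def restrictExp (ρ l : ℕ) : ℕ :=
  min (l - 1) ρ + 1 - min l ρ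

/-- `linearizedResidual` restricted to the coordinates of the Jordan chains. -/
def jordanLinearized (B : Matrix (JIdx k s) (JIdx k s) ℂ) (ρ : ℕ) :
    Matrix (JIdx k s) κ ℂ → Matrix κ κ ℂ → Matrix (JIdx k s) κ ℂ → Matrix κ κ ℂ →
      Matrix (JIdx k s) κ ℂ :=
  linearizedResidual (jordanN k s) B (scaleExp ρ ∘ jordanLevel k s)
    (perturbExp ρ ∘ jordanLevel k s) (restrictExp ρ ∘ jordanLevel k s)

/-- `residualForcing` restricted to the coordinates of the Jordan chains. -/
def jordanForcing (B : Matrix (JIdx k s) (JIdx k s) ℂ) (ρ : ℕ) :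
    Matrix (JIdx k s) κ ℂ → Matrix κ κ ℂ → Matrix (JIdx k s) κ ℂ :=
  residualForcing B (scaleExp ρ ∘ jordanLevel k s) (perturbExp ρ ∘ jordanLevel k s)
    (restrictExp ρ ∘ jordanLevel k s)

variable {B : Matrix (JIdx k s) (JIdx k s) ℂ} {ρ : ℕ}

theorem levelProj_scaleExp {a : ℕ} (ha : a < ρ) :
    levelProj (scaleExp ρ ∘ jordanLevel k s) a = levelProj (jordanLevel k s) (a + 1) := by
  rw [levelProj, levelProj]
  congr 1
  ext p
  have hp : 1 ≤ jordanLevel k s p := p.2.1.2.1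
  have hiff : scaleExp ρ (jordanLevel k s p) = a ↔ jordanLevel k s p = a + 1 := by
    rw [scaleExp]
    omega
  simp only [Function.comp_apply, hiff]

theorem rowBlk_jordanLinearized (hρ : 0 < ρ) (a x : Matrix (JIdx k s) κ ℂ) (Ω X : Matrix κ κ ℂ)
    (i : ℕ) {l : ℕ} (hl : 1 ≤ l) :
    rowBlk (jordanLinearized B ρ a Ω x X) i l = rowBlk x i (l + 1)
      + (if ρ ≤ l then rowBlk (B * (levelProj (jordanLevel k s) 1 * x)) i l else 0)
      - (if l ≤ ρ then rowBlk x i l * Ω + rowBlk a i l * X else 0) := by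
  have hg : perturbExp ρ l = 0 ↔ ρ ≤ l := by rw [perturbExp]; omega
  have hh : restrictExp ρ l = 0 ↔ l ≤ ρ := by rw [restrictExp]; omega
  simp only [jordanLinearized, linearizedResidual, levelProj_scaleExp hρ, rowBlk_sub, rowBlk_add,
    rowBlk_jordanN_mul _ _ hl, rowBlk_levelProj_mul, rowBlk_mul _ Ω, rowBlk_mul _ X, hg, hh,
    zero_add]

theorem rowBlk_jordanForcing (hρ : 2 ≤ ρ) (a : Matrix (JIdx k s) κ ℂ) (Ω : Matrix κ κ ℂ)
    (i : ℕ) {l : ℕ} (hl : 1 ≤ l) :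
    rowBlk (jordanForcing B ρ a Ω) i l = (if ρ < l then rowBlk a i l * Ω else 0)
      - (if l + 1 = ρ then rowBlk (B * (levelProj (jordanLevel k s) 1 * a)) i l else 0)
      - (if ρ ≤ l then rowBlk (B * (levelProj (jordanLevel k s) 2 * a)) i l else 0) := by
  have hg : perturbExp ρ l = 0 ↔ ρ ≤ l := by rw [perturbExp]; omega
  have hg' : perturbExp ρ l = 1 ↔ l + 1 = ρ := by rw [perturbExp]; omega
  have hh : restrictExp ρ l = 1 ↔ ρ < l := by rw [restrictExp]; omega
  simp only [jordanForcing, residualForcing, levelProj_scaleExp (by omega : 0 < ρ),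
    levelProj_scaleExp (by omega : 1 < ρ), rowBlk_sub, rowBlk_levelProj_mul, rowBlk_mul _ Ω,
    hg, hg', hh, zero_add]

end LimitEquation

section Lead

variable {k : ℕ} {s : ℕ → ℕ} {κ : Type*} [Fintype κ] [DecidableEq κ]
  (B : Matrix (JIdx k s) (JIdx k s) ℂ) (ρ : ℕ) (Q : Matrix (Fin (s ρ)) κ ℂ) (Ω : Matrix κ κ ℂ)

/-- The leading term of the scaled invariant subspace. Level `1` is `[0; Q; G Q]`, and the higher
levels follow by solving the limit equation along the Jordan chains. -/
def lead : Matrix (JIdx k s) κ ℂ :=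
  Matrix.of fun p c =>
    ((if (p.2.1 : ℕ) ≤ ρ + 1 then tBlk (IG B ρ * Q) p.1 * Ω ^ (p.2.1 - 1 : ℕ) else 0)
      - (if ρ < p.2.1 then Bhat B ρ p.1 (p.2.1 - 1) * Q else 0)) p.2.2 c

variable {B ρ Q Ω}

theorem rowBlk_lead_succ {i l : ℕ} (hik : i ≤ k) (hli : l < i) :
    rowBlk (lead B ρ Q Ω) i (l + 1)
      = (if l ≤ ρ then tBlk (IG B ρ * Q) i * Ω ^ l else 0)
        - (if ρ ≤ l then Bhat B ρ i l * Q else 0) := by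
  ext y c
  have hi : i ∈ Set.Icc 1 k := ⟨by omega, hik⟩
  have hl : l + 1 ∈ Set.Icc 1 i := ⟨by omega, hli⟩
  rw [rowBlk_apply _ hi hl]
  simp only [lead, of_apply, Nat.add_le_add_iff_right, Nat.lt_add_one_iff, Nat.add_sub_cancel]

theorem rowBlk_lead_of_le {i l : ℕ} (hik : i ≤ k) (hli : l < i) (hl : l < ρ) :
    rowBlk (lead B ρ Q Ω) i (l + 1) = tBlk (IG B ρ) i * Q * Ω ^ l := by
  rw [rowBlk_lead_succ hik hli, if_pos hl.le, if_neg hl.not_ge, sub_zero, tBlk_mul]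

theorem rowBlk_lead_of_lt {i : ℕ} (hi : i < ρ) (l : ℕ) : rowBlk (lead B ρ Q Ω) i l = 0 := by
  by_cases h : (1 ≤ i ∧ i ≤ k) ∧ (1 ≤ l ∧ l ≤ i)
  · obtain ⟨l, rfl⟩ := Nat.exists_eq_add_of_le' h.2.1
    rw [rowBlk_lead_of_le h.1.2 h.2.2 (by omega), tBlk_IG_of_lt hi, Matrix.zero_mul,
      Matrix.zero_mul]
  · exact rowBlk_void _ h

theorem rowBlk_lead_self (hρk : ρ ≤ k) {l : ℕ} (hl : l < ρ) :
    rowBlk (lead B ρ Q Ω) ρ (l + 1) = Q * Ω ^ l := by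
  rw [rowBlk_lead_of_le hρk hl hl, tBlk_IG_self hρk, Matrix.one_mul]

theorem rowsFrom_lead {m : ℕ} (hm : m < ρ) :
    rowsFrom (lead B ρ Q Ω) (ρ + 1) (m + 1) = G B ρ ρ * Q * Ω ^ m := by
  refine tBlk_ext fun j hj hjk => ?_
  rw [tBlk_rowsFrom _ _ hj, rowBlk_lead_of_le hjk (by omega) hm, tBlk_IG_of_gt hj, tBlk_mul,
    tBlk_mul]

theorem rowBlk_mul_levelProj_mul_lead (hρ : 2 ≤ ρ) (hρk : ρ ≤ k) (i l : ℕ) {m : ℕ} (hm : m < ρ) :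
    rowBlk (B * (levelProj (jordanLevel k s) (m + 1) * lead B ρ Q Ω)) i l
      = (blk B i ρ l (m + 1) + blkRow B i (ρ + 1) l (m + 1) * G B ρ ρ) * Q * Ω ^ m := by
  rw [rowBlk_mul_levelProj_mul_of_rowBlk_eq_zero hρ hρk B _ _
      fun j hj => rowBlk_lead_of_lt (by omega) _,
    rowBlk_lead_of_lt (by omega), rowBlk_lead_self hρk hm, rowsFrom_lead hm, Matrix.mul_zero,
    zero_add]
  simp only [Matrix.add_mul, Matrix.mul_assoc]

theorem rowBlk_mul_levelProj_one_mul_lead (hρ : 2 ≤ ρ) (hρk : ρ ≤ k) (i l : ℕ) :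
    rowBlk (B * (levelProj (jordanLevel k s) 1 * lead B ρ Q Ω)) i l = Bhat B ρ i l * Q := by
  rw [rowBlk_mul_levelProj_mul_lead (m := 0) hρ hρk i l (by omega), pow_zero, Matrix.mul_one, Bhat]

theorem jordanLinearized_lead (hρ : 2 ≤ ρ) (hρk : ρ ≤ k) (hW' : IsUnit (W B (ρ + 1)))
    (hQ : S B ρ * Q = Q * Ω ^ ρ) :
    jordanLinearized B ρ (lead B ρ Q Ω) Ω (lead B ρ Q Ω) 0 = 0 := by
  refine rowBlk_ext fun i l hi hik hl hli => ?_
  rw [rowBlk_jordanLinearized (by omega) _ _ _ _ _ hl, rowBlk_zero, Matrix.mul_zero, add_zero,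
    rowBlk_mul_levelProj_one_mul_lead hρ hρk]
  obtain ⟨l, rfl⟩ := Nat.exists_eq_add_of_le' hl
  rcases hli.lt_or_eq with hlt | rfl
  · -- Inside a chain, the equation is the recursion that defines `lead`.
    have hstep : (if l + 1 ≤ ρ then rowBlk (lead B ρ Q Ω) i (l + 1) * Ω else 0)
        = if l + 1 ≤ ρ then tBlk (IG B ρ * Q) i * Ω ^ (l + 1) else 0 := by
      split_ifs with h
      · rw [rowBlk_lead_of_le hik (by omega) h, tBlk_mul, Matrix.mul_assoc, ← pow_succ]
      · rfl
    rw [hstep, rowBlk_lead_succ hik hlt]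
    abel
  · rw [rowBlk_void _ (by omega), zero_add]
    rcases lt_trichotomy (l + 1) ρ with h | rfl | h
    · rw [if_neg (by omega), if_pos h.le, rowBlk_lead_of_lt h, Matrix.zero_mul, sub_zero]
    · rw [if_pos le_rfl, if_pos le_rfl, rowBlk_lead_self hρk l.lt_succ_self, Matrix.mul_assoc,
        ← pow_succ, ← hQ]
      exact sub_self _
    · rw [if_pos h.le, if_neg (by omega), Bhat_diag_eq_zero hW' h hik, Matrix.zero_mul, sub_zero]

end Lead

section Linearized

variable {k : ℕ} {s : ℕ → ℕ} {κ κ' : Type*} {B : Matrix (JIdx k s) (JIdx k s) ℂ} {ρ : ℕ}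

/-- The sub-blocks `1, …, ρ` of block `ρ`, as one block column. -/
def midBlk (ρ : ℕ) (x : Matrix (JIdx k s) κ ℂ) : Matrix (Fin ρ × Fin (s ρ)) κ ℂ :=
  Matrix.of fun p c => rowBlk x ρ (p.1 + 1) p.2 c

/-- The last sub-blocks `x_{jj}` of the blocks `j = ρ + 1, …, k`. -/
def lastRows (ρ : ℕ) (x : Matrix (JIdx k s) κ ℂ) : Matrix (TIdx (ρ + 1) k s) κ ℂ :=
  Matrix.of fun p c => rowBlk x p.1 p.1 p.2 c

theorem midBlk_mul [Fintype κ] (x : Matrix (JIdx k s) κ ℂ) (y : Matrix κ κ' ℂ) :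
    midBlk ρ (x * y) = midBlk ρ x * y := by
  ext p c
  simp only [midBlk, of_apply, rowBlk_mul]
  rfl

theorem prodBlk_midBlk (x : Matrix (JIdx k s) κ ℂ) {l : ℕ} (hl : l < ρ) :
    prodBlk (midBlk ρ x) l = rowBlk x ρ (l + 1) := by
  ext y c
  simp [prodBlk, midBlk, hl]

theorem rowBlk_eq_zero_of_midBlk_eq_zero {x : Matrix (JIdx k s) κ ℂ} (h : midBlk ρ x = 0) (l : ℕ) :
    rowBlk x ρ l = 0 := by
  by_cases hl : (1 ≤ ρ ∧ ρ ≤ k) ∧ (1 ≤ l ∧ l ≤ ρ)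
  · obtain ⟨l, rfl⟩ := Nat.exists_eq_add_of_le' hl.2.1
    rw [← prodBlk_midBlk x hl.2.2, h, prodBlk_zero]
  · exact rowBlk_void _ hl

theorem tBlk_lastRows (x : Matrix (JIdx k s) κ ℂ) {j : ℕ} (hj : ρ < j) :
    tBlk (lastRows ρ x) j = rowBlk x j j := by
  by_cases hjk : j ≤ k
  · ext y c
    exact tBlk_apply (lastRows ρ x) ⟨⟨j, hj, hjk⟩, y⟩ c
  · rw [rowBlk_void _ (by omega)]
    ext y c
    simp [tBlk, hjk]

theorem lastRows_zero : lastRows ρ (0 : Matrix (JIdx k s) κ ℂ) = 0 :=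
  tBlk_ext fun j hj _ => by rw [tBlk_lastRows 0 hj, rowBlk_zero, tBlk_zero]

variable [Fintype κ] [DecidableEq κ] {Q : Matrix (Fin (s ρ)) κ ℂ} {Ω X : Matrix κ κ ℂ}
  {x e : Matrix (JIdx k s) κ ℂ}

theorem midBlk_lead {S : Matrix (Fin (s ρ)) (Fin (s ρ)) ℂ}
    {Φ : Matrix (Fin ρ × Fin (s ρ)) κ ℂ} (hρk : ρ ≤ k) (hΦ : blockCompanion ρ S * Φ = Φ * Ω) :
    midBlk ρ (lead B ρ (prodBlk Φ 0) Ω) = Φ :=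
  prodBlk_ext fun l hl => by
    rw [prodBlk_midBlk _ hl, rowBlk_lead_self hρk hl, prodBlk_of_blockCompanion_mul_eq hΦ hl]

theorem rowBlk_eq_mul_pow_of_lt (h : jordanLinearized B ρ (lead B ρ Q Ω) Ω x X = e) {i : ℕ}
    (hi : i < ρ) (he : ∀ l < i, rowBlk e i l = 0) {l : ℕ} (hl : l < i) :
    rowBlk x i (l + 1) = rowBlk x i 1 * Ω ^ l := by
  induction l with
  | zero => simp
  | succ l ih =>
    have heq := rowBlk_jordanLinearized (B := B) (by omega : 0 < ρ) (lead B ρ Q Ω) x Ω X i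
      (by omega : 1 ≤ l + 1)
    rwa [h, he _ hl, if_neg (by omega), if_pos (by omega), rowBlk_lead_of_lt hi, Matrix.zero_mul,
      add_zero, add_zero, eq_comm, sub_eq_zero, ih (by omega), Matrix.mul_assoc, ← pow_succ] at heq

theorem rowBlk_one_mul_pow_of_lt (h : jordanLinearized B ρ (lead B ρ Q Ω) Ω x X = e) {i : ℕ}
    (hi : i < ρ) (he : ∀ l < i, rowBlk e i l = 0) : rowBlk x i 1 * Ω ^ i = -rowBlk e i i := by
  rcases i with _ | i
  · rw [rowBlk_void _ (by omega), rowBlk_void _ (by omega), Matrix.zero_mul, neg_zero]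
  · have heq := rowBlk_jordanLinearized (B := B) (by omega : 0 < ρ) (lead B ρ Q Ω) x Ω X (i + 1)
      (by omega : 1 ≤ i + 1)
    rw [h, if_neg (by omega), if_pos (by omega), rowBlk_lead_of_lt hi, Matrix.zero_mul, add_zero,
      add_zero, rowBlk_void x (l := i + 1 + 1) (by omega), zero_sub,
      rowBlk_eq_mul_pow_of_lt h hi he i.lt_succ_self, Matrix.mul_assoc, ← pow_succ] at heq
    rw [heq, neg_neg]

theorem rowBlk_eq_zero_of_lt (h : jordanLinearized B ρ (lead B ρ Q Ω) Ω x X = e) (hΩ : IsUnit Ω)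
    {i : ℕ} (hi : i < ρ) (he : ∀ l ≤ i, rowBlk e i l = 0) (l : ℕ) : rowBlk x i l = 0 := by
  by_cases hl : (1 ≤ i ∧ i ≤ k) ∧ (1 ≤ l ∧ l ≤ i)
  swap
  · exact rowBlk_void _ hl
  have he' : ∀ l < i, rowBlk e i l = 0 := fun l hl => he l hl.le
  have hone : rowBlk x i 1 = 0 := by
    rw [eq_mul_inv_of_mul_eq (hΩ.pow i) (rowBlk_one_mul_pow_of_lt h hi he'), he i le_rfl, neg_zero,
      Matrix.zero_mul]
  obtain ⟨l, rfl⟩ := Nat.exists_eq_add_of_le' hl.2.1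
  rw [rowBlk_eq_mul_pow_of_lt h hi he' hl.2.2, hone, Matrix.zero_mul]

theorem rowsFrom_one_eq (h : jordanLinearized B ρ (lead B ρ Q Ω) Ω x X = e) (hρ : 2 ≤ ρ)
    (hρk : ρ ≤ k) (hW' : IsUnit (W B (ρ + 1))) (hx : ∀ i < ρ - 1, ∀ l, rowBlk x i l = 0) :
    rowsFrom x (ρ + 1) 1 = (W B (ρ + 1))⁻¹ * lastRows ρ e
      + G B ρ (ρ - 1) * rowBlk x (ρ - 1) 1 + G B ρ ρ * rowBlk x ρ 1 := by
  have hlast : Z B (ρ + 1) (ρ - 1) * rowBlk x (ρ - 1) 1 + Z B (ρ + 1) ρ * rowBlk x ρ 1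
      + W B (ρ + 1) * rowsFrom x (ρ + 1) 1 = lastRows ρ e := by
    refine tBlk_ext fun j hj hjk => ?_
    rw [tBlk_lastRows e hj, ← h, rowBlk_jordanLinearized (by omega) _ _ _ _ _ (by omega),
      rowBlk_void x (l := j + 1) (by omega), if_pos (by omega), if_neg (by omega), zero_add,
      sub_zero, rowBlk_mul_levelProj_mul_of_rowBlk_eq_zero hρ hρk B x 1 fun i hi => hx i hi 1,
      tBlk_add, tBlk_add, tBlk_mul, tBlk_mul, tBlk_Z B hj hjk, tBlk_Z B hj hjk,
      tBlk_W_mul B _ hj hjk]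
  rw [eq_inv_mul_of_mul_eq hW' (eq_sub_of_add_eq' hlast), G, G]
  simp only [Matrix.mul_sub, Matrix.mul_add, Matrix.neg_mul, Matrix.mul_assoc]
  abel

/-- The right-hand side of the Sylvester equation that block `ρ` of `x` satisfies when
`jordanLinearized B ρ (lead B ρ Q Ω) Ω x X = e`. -/
def midRhs (B : Matrix (JIdx k s) (JIdx k s) ℂ) (ρ : ℕ) (x e : Matrix (JIdx k s) κ ℂ) (l : ℕ) :
    Matrix (Fin (s ρ)) κ ℂ :=
  rowBlk e ρ (l + 1) - if l + 1 < ρ then 0 else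
    blk B ρ (ρ - 1) ρ 1 * rowBlk x (ρ - 1) 1 + blkRow B ρ (ρ + 1) ρ 1
      * ((W B (ρ + 1))⁻¹ * lastRows ρ e + G B ρ (ρ - 1) * rowBlk x (ρ - 1) 1)

theorem prodBlk_sylvester_eq_midRhs (h : jordanLinearized B ρ (lead B ρ Q Ω) Ω x X = e)
    (hρ : 2 ≤ ρ) (hρk : ρ ≤ k) (hW' : IsUnit (W B (ρ + 1)))
    (hx : ∀ i < ρ - 1, ∀ l, rowBlk x i l = 0) {Φ : Matrix (Fin ρ × Fin (s ρ)) κ ℂ}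
    (hΦ : ∀ l < ρ, prodBlk Φ l = Q * Ω ^ l) {l : ℕ} (hl : l < ρ) :
    prodBlk (blockCompanion ρ (S B ρ) * midBlk ρ x - midBlk ρ x * Ω - Φ * X) l
      = midRhs B ρ x e l := by
  have heq := rowBlk_jordanLinearized (B := B) (by omega : 0 < ρ) (lead B ρ Q Ω) x Ω X ρ
    (by omega : 1 ≤ l + 1)
  rw [h, if_pos (by omega : l + 1 ≤ ρ), rowBlk_lead_self hρk hl] at heq
  rw [prodBlk_sub, prodBlk_sub, prodBlk_mul (midBlk ρ x), prodBlk_mul Φ, prodBlk_midBlk x hl,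
    hΦ l hl, midRhs, heq]
  by_cases hl' : l + 1 < ρ
  · rw [prodBlk_blockCompanion_mul_of_lt _ _ hl', prodBlk_midBlk x hl', if_pos hl',
      if_neg (by omega)]
    abel
  · obtain rfl : l = ρ - 1 := by omega
    rw [prodBlk_blockCompanion_mul_last _ _ (by omega), prodBlk_midBlk x (by omega), if_neg hl',
      if_pos (by omega), rowBlk_void x (l := ρ - 1 + 1 + 1) (by omega), zero_add,
      rowBlk_mul_levelProj_mul_of_rowBlk_eq_zero hρ hρk B x 1 fun j hj => hx j hj 1,
      rowsFrom_one_eq h hρ hρk hW' hx, S, Nat.sub_add_cancel (by omega : 1 ≤ ρ)]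
    simp only [Matrix.mul_add, Matrix.add_mul, Matrix.mul_assoc, zero_add]
    abel

variable {κc : Type*} [Fintype κc] [DecidableEq κc] {Φ : Matrix (Fin ρ × Fin (s ρ)) κ ℂ}
  {Φc : Matrix (Fin ρ × Fin (s ρ)) κc ℂ} {Ωc : Matrix κc κc ℂ}
  {P : Matrix κ (Fin ρ × Fin (s ρ)) ℂ} {Pc : Matrix κc (Fin ρ × Fin (s ρ)) ℂ}

theorem rowBlk_eq_zero_of_jordanLinearized_eq_zero
    (h : jordanLinearized B ρ (lead B ρ Q Ω) Ω x 0 = 0) (hρ : 2 ≤ ρ) (hρk : ρ ≤ k)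
    (hW' : IsUnit (W B (ρ + 1))) (hx : ∀ i ≤ ρ, ∀ l, rowBlk x i l = 0) {i l : ℕ} (hi : ρ < i)
    (hl : 1 ≤ l) (hli : l ≤ i) : rowBlk x i l = 0 := by
  have hsmall : ∀ i < ρ - 1, ∀ l, rowBlk x i l = 0 := fun i hi => hx i (by omega)
  have hone : rowsFrom x (ρ + 1) 1 = 0 := by
    rw [rowsFrom_one_eq h hρ hρk hW' hsmall, lastRows_zero, hx (ρ - 1) (by omega), hx ρ le_rfl]
    simp only [Matrix.mul_zero, add_zero]
  induction l, hl using Nat.le_induction with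
  | base => rw [← tBlk_rowsFrom x 1 hi, hone, tBlk_zero]
  | succ l hl ih =>
    have heq := rowBlk_jordanLinearized (B := B) (by omega : 0 < ρ) (lead B ρ Q Ω) x Ω 0 i hl
    rw [h, rowBlk_zero, rowBlk_mul_levelProj_mul_of_rowBlk_eq_zero hρ hρk B x 1
      fun j hj => hsmall j hj 1, hone, hx (ρ - 1) (by omega), hx ρ le_rfl, ih (by omega)] at heq
    simpa using heq.symm

theorem eq_zero_of_jordanLinearized_eq_zero
    (hs : IsSpectralSplitting (blockCompanion ρ (S B ρ)) Φ Φc Ω Ωc P Pc)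
    (h : jordanLinearized B ρ (lead B ρ (prodBlk Φ 0) Ω) Ω x X = 0) (hρ : 2 ≤ ρ) (hρk : ρ ≤ k)
    (hW : IsUnit (W B ρ)) (hW' : IsUnit (W B (ρ + 1))) (hx : P * midBlk ρ x = 0) :
    x = 0 ∧ X = 0 := by
  have hΩ : IsUnit Ω := hs.isUnit (isUnit_blockCompanion (by omega) (isUnit_S hρk hW hW'))
  have hsmall : ∀ i < ρ, ∀ l, rowBlk x i l = 0 := fun i hi =>
    rowBlk_eq_zero_of_lt h hΩ hi fun l _ => rowBlk_zero i l
  have hsylvester :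
      blockCompanion ρ (S B ρ) * midBlk ρ x - midBlk ρ x * Ω - Φ * X = 0 := by
    refine prodBlk_ext fun l hl => ?_
    rw [prodBlk_sylvester_eq_midRhs h hρ hρk hW' (fun i hi => hsmall i (by omega))
      (fun l hl => prodBlk_of_blockCompanion_mul_eq hs.mul_left hl) hl, midRhs, rowBlk_zero,
      lastRows_zero, hsmall (ρ - 1) (by omega)]
    simp [prodBlk_zero]
  obtain ⟨hmid, rfl⟩ := hs.eq_zero_of_sylvester hsylvester hx
  have hupTo : ∀ i ≤ ρ, ∀ l, rowBlk x i l = 0 := fun i hi l => by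
    rcases hi.lt_or_eq with hi | rfl
    · exact hsmall i hi l
    · exact rowBlk_eq_zero_of_midBlk_eq_zero hmid l
  refine ⟨rowBlk_ext fun i l _ _ hl hli => ?_, rfl⟩
  rw [rowBlk_zero]
  rcases le_or_gt i ρ with hi | hi
  · exact hupTo i hi l
  · exact rowBlk_eq_zero_of_jordanLinearized_eq_zero h hρ hρk hW' hupTo hi hl hli

end Linearized

section FirstOrder

variable {k : ℕ} {s : ℕ → ℕ} {κ : Type*} [Fintype κ] [DecidableEq κ]
  {B : Matrix (JIdx k s) (JIdx k s) ℂ} {ρ : ℕ} {Q : Matrix (Fin (s ρ)) κ ℂ} {Ω X : Matrix κ κ ℂ}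
  {x : Matrix (JIdx k s) κ ℂ}

theorem rowBlk_jordanForcing_lead (hρ : 2 ≤ ρ) (hρk : ρ ≤ k) (i : ℕ) {l : ℕ} (hl : 1 ≤ l) :
    rowBlk (jordanForcing B ρ (lead B ρ Q Ω) Ω) i l
      = (if ρ < l then rowBlk (lead B ρ Q Ω) i l * Ω else 0)
        - (if l + 1 = ρ then Bhat B ρ i l * Q else 0)
        - (if ρ ≤ l then (blk B i ρ l 2 + blkRow B i (ρ + 1) l 2 * G B ρ ρ) * Q * Ω else 0) := by
  rw [rowBlk_jordanForcing hρ _ _ _ hl, rowBlk_mul_levelProj_one_mul_lead hρ hρk,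
    rowBlk_mul_levelProj_mul_lead hρ hρk i l (m := 1) (by omega), pow_one]

theorem rowBlk_jordanForcing_lead_of_lt (hρ : 2 ≤ ρ) (hρk : ρ ≤ k) (i : ℕ) {l : ℕ}
    (hl : l + 1 < ρ) : rowBlk (jordanForcing B ρ (lead B ρ Q Ω) Ω) i l = 0 := by
  rcases l with _ | l
  · exact rowBlk_void _ (by omega)
  · rw [rowBlk_jordanForcing_lead hρ hρk i (by omega), if_neg (by omega), if_neg (by omega),
      if_neg (by omega), sub_zero, sub_zero]

theorem rowBlk_jordanForcing_lead_pred (hρ : 2 ≤ ρ) (hρk : ρ ≤ k) (i : ℕ) :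
    rowBlk (jordanForcing B ρ (lead B ρ Q Ω) Ω) i (ρ - 1) = -(Bhat B ρ i (ρ - 1) * Q) := by
  rw [rowBlk_jordanForcing_lead hρ hρk i (by omega), if_neg (by omega), if_pos (by omega),
    if_neg (by omega), sub_zero, zero_sub]

theorem tBlk_Ctilde {i : ℕ} (hi : ρ < i) (hik : i ≤ k) :
    tBlk (Ctilde B ρ) i = (if i = ρ + 1 then tBlk (G B ρ ρ) i * S B ρ else 0)
      - (Bhat B ρ i (i - 1) + blk B i ρ i 2 + blkRow B i (ρ + 1) i 2 * G B ρ ρ) := by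
  ext y c
  have hi' : i ∈ Set.Icc (ρ + 1) k := ⟨hi, hik⟩
  have hC : tBlk (Ctilde B ρ) i y c = Ctilde B ρ ⟨⟨i, hi'⟩, y⟩ c :=
    tBlk_apply (Ctilde B ρ) ⟨⟨i, hi'⟩, y⟩ c
  have hG : tBlk (G B ρ ρ * S B ρ) i y c = (G B ρ ρ * S B ρ) ⟨⟨i, hi'⟩, y⟩ c :=
    tBlk_apply (G B ρ ρ * S B ρ) ⟨⟨i, hi'⟩, y⟩ c
  rw [← tBlk_mul, hC, Matrix.sub_apply]
  by_cases hi1 : i = ρ + 1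
  · rw [if_pos hi1, hG]
    simp [Ctilde, hi1]
  · rw [if_neg hi1]
    simp [Ctilde, hi1]

theorem rowBlk_lead_diag {i : ℕ} (hi : ρ < i) (hik : i ≤ k) (hQ : S B ρ * Q = Q * Ω ^ ρ) :
    rowBlk (lead B ρ Q Ω) i i
      = ((if i = ρ + 1 then tBlk (G B ρ ρ) i * S B ρ else 0) - Bhat B ρ i (i - 1)) * Q := by
  obtain ⟨l, rfl⟩ := Nat.exists_eq_add_of_le' (by omega : 1 ≤ i)
  rw [rowBlk_lead_succ hik (by omega), if_pos (by omega : ρ ≤ l), Nat.add_sub_cancel,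
    Matrix.sub_mul]
  by_cases hl : l = ρ
  · rw [if_pos hl.le, if_pos (by omega), tBlk_mul, tBlk_IG_of_gt hi, hl, Matrix.mul_assoc,
      Matrix.mul_assoc, hQ]
  · rw [if_neg (by omega), if_neg (by omega), Matrix.zero_mul]

theorem lastRows_jordanForcing_lead (hρ : 2 ≤ ρ) (hρk : ρ ≤ k) (hQ : S B ρ * Q = Q * Ω ^ ρ) :
    lastRows ρ (jordanForcing B ρ (lead B ρ Q Ω) Ω) = Ctilde B ρ * Q * Ω := by
  refine tBlk_ext fun i hi hik => ?_
  rw [tBlk_lastRows _ hi, rowBlk_jordanForcing_lead hρ hρk i (by omega), if_pos (by omega),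
    if_neg (by omega), if_pos (by omega), rowBlk_lead_diag hi hik hQ, tBlk_mul, tBlk_mul,
    tBlk_Ctilde hi hik]
  simp only [Matrix.add_mul, Matrix.sub_mul]
  abel

section Solution

variable (h : jordanLinearized B ρ (lead B ρ Q Ω) Ω x X = jordanForcing B ρ (lead B ρ Q Ω) Ω)
  (hρ : 2 ≤ ρ) (hρk : ρ ≤ k) (hΩ : IsUnit Ω)
include h hρ hρk hΩ

theorem rowBlk_first_order_of_lt_pred {i : ℕ} (hi : i < ρ - 1) (l : ℕ) : rowBlk x i l = 0 :=
  rowBlk_eq_zero_of_lt h hΩ (by omega)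
    (fun _ hl => rowBlk_jordanForcing_lead_of_lt hρ hρk i (by omega)) l

variable (hS : IsUnit (S B ρ)) (hQ : S B ρ * Q = Q * Ω ^ ρ)
include hS hQ

theorem rowBlk_pred_one_first_order :
    rowBlk x (ρ - 1) 1 = Bhat B ρ (ρ - 1) (ρ - 1) * (S B ρ)⁻¹ * Q * Ω := by
  have hlast : rowBlk x (ρ - 1) 1 * Ω ^ (ρ - 1) = Bhat B ρ (ρ - 1) (ρ - 1) * Q := by
    rw [rowBlk_one_mul_pow_of_lt h (by omega)
      fun l hl => rowBlk_jordanForcing_lead_of_lt hρ hρk _ (by omega),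
      rowBlk_jordanForcing_lead_pred hρ hρk, neg_neg]
  have hQ' : (S B ρ)⁻¹ * Q * Ω * Ω ^ (ρ - 1) = Q := by
    rw [Matrix.mul_assoc, ← pow_succ', Nat.sub_add_cancel (by omega), Matrix.mul_assoc, ← hQ,
      ← eq_inv_mul_of_mul_eq hS rfl]
  rw [eq_mul_inv_of_mul_eq (hΩ.pow _) hlast, Matrix.mul_assoc,
    ← eq_mul_inv_of_mul_eq (hΩ.pow _) hQ']
  simp only [Matrix.mul_assoc]

theorem Cmat_mul_eq_first_order :
    (W B (ρ + 1))⁻¹ * lastRows ρ (jordanForcing B ρ (lead B ρ Q Ω) Ω)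
      + G B ρ (ρ - 1) * rowBlk x (ρ - 1) 1 = Cmat B ρ * Q * Ω := by
  rw [lastRows_jordanForcing_lead hρ hρk hQ, rowBlk_pred_one_first_order h hρ hρk hΩ hS hQ, Cmat]
  simp only [Matrix.add_mul, Matrix.mul_assoc]

theorem rowsFrom_one_first_order (hW' : IsUnit (W B (ρ + 1))) :
    rowsFrom x (ρ + 1) 1 = Cmat B ρ * Q * Ω + G B ρ ρ * rowBlk x ρ 1 := by
  rw [rowsFrom_one_eq h hρ hρk hW' fun i hi => rowBlk_first_order_of_lt_pred h hρ hρk hΩ hi,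
    Cmat_mul_eq_first_order h hρ hρk hΩ hS hQ]

theorem midRhs_first_order_last :
    midRhs B ρ x (jordanForcing B ρ (lead B ρ Q Ω) Ω) (ρ - 1) = -(Bhat2 B ρ * Q * Ω) := by
  rw [midRhs, if_neg (by omega), Cmat_mul_eq_first_order h hρ hρk hΩ hS hQ,
    rowBlk_pred_one_first_order h hρ hρk hΩ hS hQ, Nat.sub_add_cancel (by omega),
    rowBlk_jordanForcing_lead hρ hρk ρ (by omega), if_neg (by omega), if_neg (by omega),
    if_pos le_rfl, Bhat2]
  simp only [Matrix.add_mul, Matrix.mul_assoc]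
  abel

end Solution

theorem midRhs_jordanForcing_lead_of_lt (hρ : 2 ≤ ρ) (hρk : ρ ≤ k) {l : ℕ} (hl : l + 2 < ρ) :
    midRhs B ρ x (jordanForcing B ρ (lead B ρ Q Ω) Ω) l = 0 := by
  rw [midRhs, if_pos (by omega), sub_zero, rowBlk_jordanForcing_lead_of_lt hρ hρk ρ (by omega)]

theorem midRhs_jordanForcing_lead_sub_two (hρ : 2 ≤ ρ) (hρk : ρ ≤ k) :
    midRhs B ρ x (jordanForcing B ρ (lead B ρ Q Ω) Ω) (ρ - 2) = -(Bhat B ρ ρ (ρ - 1) * Q) := by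
  rw [midRhs, if_pos (by omega), sub_zero, (by omega : ρ - 2 + 1 = ρ - 1),
    rowBlk_jordanForcing_lead_pred hρ hρk]

end FirstOrder

section FirstOrderBlock

variable {k : ℕ} {s : ℕ → ℕ} {r r' : ℕ} {B : Matrix (JIdx k s) (JIdx k s) ℂ} {ρ : ℕ}

theorem Delta_toBlocks₁₁ (Ω : Matrix (Fin r) (Fin r) ℂ) (Ωc : Matrix (Fin r') (Fin r') ℂ)
    (Q₁ : Matrix (Fin (s ρ)) (Fin r) ℂ) (Q₂ : Matrix (Fin (s ρ)) (Fin r') ℂ)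
    (Qt₁ : Matrix (Fin r) (Fin (s ρ)) ℂ) (Qt₂ : Matrix (Fin r') (Fin (s ρ)) ℂ) :
    (Delta B ρ Ω Ωc Q₁ Q₂ Qt₁ Qt₂).toBlocks₁₁ = (Msum ρ Ω Qt₁ Q₁)⁻¹
      * (Ω * Qt₁ * (Bhat B ρ ρ (ρ - 1) * Q₁) + Qt₁ * (Bhat2 B ρ * Q₁ * Ω)) := by
  simp only [Delta, fromBlocks_multiply, toBlocks_fromBlocks₁₁, Matrix.zero_mul, Matrix.mul_zero,
    add_zero, zero_add, Matrix.mul_add, Matrix.mul_assoc]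

theorem Delta_toBlocks₂₁ (Ω : Matrix (Fin r) (Fin r) ℂ) (Ωc : Matrix (Fin r') (Fin r') ℂ)
    (Q₁ : Matrix (Fin (s ρ)) (Fin r) ℂ) (Q₂ : Matrix (Fin (s ρ)) (Fin r') ℂ)
    (Qt₁ : Matrix (Fin r) (Fin (s ρ)) ℂ) (Qt₂ : Matrix (Fin r') (Fin (s ρ)) ℂ) :
    (Delta B ρ Ω Ωc Q₁ Q₂ Qt₁ Qt₂).toBlocks₂₁ = (Msum ρ Ωc Qt₂ Q₂)⁻¹
      * (Ωc * Qt₂ * (Bhat B ρ ρ (ρ - 1) * Q₁) + Qt₂ * (Bhat2 B ρ * Q₁ * Ω)) := by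
  simp only [Delta, fromBlocks_multiply, toBlocks_fromBlocks₂₁, Matrix.zero_mul, Matrix.mul_zero,
    add_zero, zero_add, Matrix.mul_add, Matrix.mul_assoc]

variable {Φ : Matrix (Fin ρ × Fin (s ρ)) (Fin r) ℂ} {Φc : Matrix (Fin ρ × Fin (s ρ)) (Fin r') ℂ}
  {Ω X : Matrix (Fin r) (Fin r) ℂ} {Ωc : Matrix (Fin r') (Fin r') ℂ}
  {P : Matrix (Fin r) (Fin ρ × Fin (s ρ)) ℂ} {Pc : Matrix (Fin r') (Fin ρ × Fin (s ρ)) ℂ}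
  {x : Matrix (JIdx k s) (Fin r) ℂ}

/-- The block `ρ` of the equation for the first order terms, as a residual of the bordered Sylvester
equation. -/
abbrev sylvesterResidual (B : Matrix (JIdx k s) (JIdx k s) ℂ) (ρ : ℕ)
    (Φ : Matrix (Fin ρ × Fin (s ρ)) (Fin r) ℂ) (Ω : Matrix (Fin r) (Fin r) ℂ)
    (x : Matrix (JIdx k s) (Fin r) ℂ) (X : Matrix (Fin r) (Fin r) ℂ) :
    Matrix (Fin ρ × Fin (s ρ)) (Fin r) ℂ :=
  blockCompanion ρ (S B ρ) * midBlk ρ x - midBlk ρ x * Ω - Φ * X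

variable (hs : IsSpectralSplitting (blockCompanion ρ (S B ρ)) Φ Φc Ω Ωc P Pc)
  (h : jordanLinearized B ρ (lead B ρ (prodBlk Φ 0) Ω) Ω x X
    = jordanForcing B ρ (lead B ρ (prodBlk Φ 0) Ω) Ω)
  (hρ : 2 ≤ ρ) (hρk : ρ ≤ k) (hW : IsUnit (W B ρ)) (hW' : IsUnit (W B (ρ + 1)))
include hs h hρ hρk hW hW'

theorem dual_mul_sylvesterResidual {m m' : ℕ} {Ψ : Matrix (Fin ρ × Fin (s ρ)) (Fin m) ℂ}
    {Ψc : Matrix (Fin ρ × Fin (s ρ)) (Fin m') ℂ} {Λ : Matrix (Fin m) (Fin m) ℂ}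
    {Λc : Matrix (Fin m') (Fin m') ℂ} {R : Matrix (Fin m) (Fin ρ × Fin (s ρ)) ℂ}
    {Rc : Matrix (Fin m') (Fin ρ × Fin (s ρ)) ℂ}
    (ht : IsSpectralSplitting (blockCompanion ρ (S B ρ)) Ψ Ψc Λ Λc R Rc)
    {Qt : Matrix (Fin m) (Fin (s ρ)) ℂ} (hQt : Qt * S B ρ = Λ ^ ρ * Qt)
    (hM : IsUnit (Msum ρ Λ Qt (prodBlk Ψ 0))) :
    R * sylvesterResidual B ρ Φ Ω x X = -((Msum ρ Λ Qt (prodBlk Ψ 0))⁻¹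
      * (Λ * Qt * (Bhat B ρ ρ (ρ - 1) * prodBlk Φ 0)
        + Qt * (Bhat2 B ρ * prodBlk Φ 0 * Ω))) := by
  have hS := isUnit_S hρk hW hW'
  have hΩ : IsUnit Ω := hs.isUnit (isUnit_blockCompanion (by omega) hS)
  have hQ := mul_prodBlk_zero_of_blockCompanion_mul_eq (by omega) hs.mul_left
  have hblk {l : ℕ} (hl : l < ρ) := prodBlk_sylvester_eq_midRhs h hρ hρk hW'
    (fun i hi => rowBlk_first_order_of_lt_pred h hρ hρk hΩ hi)
    (fun l hl => prodBlk_of_blockCompanion_mul_eq hs.mul_left hl) hl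
  rw [← leftRow_mul_eq_Msum ht.mul_left] at hM ⊢
  rw [dual_mul_of_prodBlk_eq_zero ht hρ hQt hM fun l hl => by
      rw [hblk (by omega), midRhs_jordanForcing_lead_of_lt hρ hρk hl],
    hblk (by omega), hblk (by omega), midRhs_jordanForcing_lead_sub_two hρ hρk,
    midRhs_first_order_last h hρ hρk hΩ hS hQ]
  simp only [Matrix.mul_neg, ← neg_add]

variable (hx : P * midBlk ρ x = 0)
include hx

theorem eq_Delta_toBlocks₁₁ (Qt₂ : Matrix (Fin r') (Fin (s ρ)) ℂ)
    {Qt₁ : Matrix (Fin r) (Fin (s ρ)) ℂ} (hQt₁ : Qt₁ * S B ρ = Ω ^ ρ * Qt₁)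
    (hM : IsUnit (Msum ρ Ω Qt₁ (prodBlk Φ 0))) :
    X = (Delta B ρ Ω Ωc (prodBlk Φ 0) (prodBlk Φc 0) Qt₁ Qt₂).toBlocks₁₁ := by
  refine (hs.eq_neg_dual_mul (X := X) rfl hx).trans ?_
  rw [dual_mul_sylvesterResidual hs h hρ hρk hW hW' hs hQt₁ hM, neg_neg, Delta_toBlocks₁₁]

theorem rowBlk_self_one_first_order (Qt₁ : Matrix (Fin r) (Fin (s ρ)) ℂ)
    {Qt₂ : Matrix (Fin r') (Fin (s ρ)) ℂ} (hQt₂ : Qt₂ * S B ρ = Ωc ^ ρ * Qt₂)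
    (hMc : IsUnit (Msum ρ Ωc Qt₂ (prodBlk Φc 0))) {Y : Matrix (Fin r') (Fin r) ℂ}
    (hY : Ωc * Y - Y * Ω
      + (Delta B ρ Ω Ωc (prodBlk Φ 0) (prodBlk Φc 0) Qt₁ Qt₂).toBlocks₂₁ = 0) :
    rowBlk x ρ 1 = prodBlk Φc 0 * Y := by
  have hPc : Ωc * (Pc * midBlk ρ x) - Pc * midBlk ρ x * Ω = Ωc * Y - Y * Ω := by
    rw [hs.dualc_sylvester rfl, dual_mul_sylvesterResidual hs h hρ hρk hW hW' hs.symm hQt₂ hMc,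
      ← Delta_toBlocks₂₁ Ω Ωc _ _ Qt₁, eq_neg_of_add_eq_zero_left hY]
  have hY' : Pc * midBlk ρ x = Y := by
    rw [← sub_eq_zero]
    refine eq_zero_of_disjoint_spectrum hs.disjoint.symm ?_
    rw [Matrix.mul_sub, Matrix.sub_mul, sub_eq_sub_iff_sub_eq_sub, hPc]
  rw [← prodBlk_midBlk x (by omega), hs.eq_mul_dualc hx, hY', prodBlk_mul]

end FirstOrderBlock

section Embedding

variable {k : ℕ} {s : ℕ → ℕ} {β κ : Type*} {ρ : ℕ}

/-- The level of a coordinate of the full space; the coordinates that complete the Jordan chains to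
a basis have level `0`. -/
def fullLevel (k : ℕ) (s : ℕ → ℕ) (β : Type*) : JIdx k s ⊕ β → ℕ :=
  Sum.elim (jordanLevel k s) fun _ => 0

theorem fromRows_add_fromRows {m : Type*} (x x' : Matrix m κ ℂ) (y y' : Matrix β κ ℂ) :
    fromRows x y + fromRows x' y' = fromRows (x + x') (y + y') := by
  ext (p | p) c <;> rfl

theorem fromRows_sub_fromRows {m : Type*} (x x' : Matrix m κ ℂ) (y y' : Matrix β κ ℂ) :
    fromRows x y - fromRows x' y' = fromRows (x - x') (y - y') := by
  ext (p | p) c <;> rfl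

variable [Fintype β]

theorem mul_fromRows_zero (D : Matrix (JIdx k s ⊕ β) (JIdx k s ⊕ β) ℂ)
    (x : Matrix (JIdx k s) κ ℂ) :
    D * fromRows x (0 : Matrix β κ ℂ) = fromRows (D.toBlocks₁₁ * x) (D.toBlocks₂₁ * x) := by
  ext (p | p) c <;> simp [Matrix.mul_apply, toBlocks₁₁, toBlocks₂₁]

variable [DecidableEq β] {M : Matrix β β ℂ} {D : Matrix (JIdx k s ⊕ β) (JIdx k s ⊕ β) ℂ}

theorem levelProj_mul_fromRows (f : ℕ → ℕ) (a : ℕ) (x : Matrix (JIdx k s) κ ℂ)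
    (y : Matrix β κ ℂ) :
    levelProj (f ∘ fullLevel k s β) a * fromRows x y
      = fromRows (levelProj (f ∘ jordanLevel k s) a * x) (if f 0 = a then y else 0) := by
  ext (p | p) c
  · rw [levelProj, levelProj, diagonal_mul, fromRows_apply_inl, fromRows_apply_inl, diagonal_mul]
    rfl
  · rw [levelProj, diagonal_mul, fromRows_apply_inr, fromRows_apply_inr]
    change (if f 0 = a then 1 else 0) * y p c = _
    split_ifs <;> simp

variable [Fintype κ] {a : Matrix (JIdx k s) κ ℂ} {Ω X : Matrix κ κ ℂ}

/-- The scaled invariant subspace equation for `fromBlocks (jordanN k s) 0 0 M + c ^ ρ • D`. -/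
abbrev fullResidual (M : Matrix β β ℂ) (D : Matrix (JIdx k s ⊕ β) (JIdx k s ⊕ β) ℂ) (ρ : ℕ) :
    ℂ → Matrix (JIdx k s ⊕ β) κ ℂ → Matrix κ κ ℂ → Matrix (JIdx k s ⊕ β) κ ℂ :=
  scaledResidual (fromBlocks (jordanN k s) 0 0 M) D (scaleExp ρ ∘ fullLevel k s β)
    (perturbExp ρ ∘ fullLevel k s β) (restrictExp ρ ∘ fullLevel k s β)

/-- The linearization of `fullResidual` at `c = 0`. -/
abbrev fullLinearized (M : Matrix β β ℂ) (D : Matrix (JIdx k s ⊕ β) (JIdx k s ⊕ β) ℂ) (ρ : ℕ) :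
    Matrix (JIdx k s ⊕ β) κ ℂ → Matrix κ κ ℂ → Matrix (JIdx k s ⊕ β) κ ℂ → Matrix κ κ ℂ →
      Matrix (JIdx k s ⊕ β) κ ℂ :=
  linearizedResidual (fromBlocks (jordanN k s) 0 0 M) D (scaleExp ρ ∘ fullLevel k s β)
    (perturbExp ρ ∘ fullLevel k s β) (restrictExp ρ ∘ fullLevel k s β)

/-- Minus the derivative of `fullResidual` with respect to `c` at `c = 0`. -/
abbrev fullForcing (D : Matrix (JIdx k s ⊕ β) (JIdx k s ⊕ β) ℂ) (ρ : ℕ) :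
    Matrix (JIdx k s ⊕ β) κ ℂ → Matrix κ κ ℂ → Matrix (JIdx k s ⊕ β) κ ℂ :=
  residualForcing D (scaleExp ρ ∘ fullLevel k s β) (perturbExp ρ ∘ fullLevel k s β)
    (restrictExp ρ ∘ fullLevel k s β)

theorem fullLinearized_fromRows (hρ : 0 < ρ) (x : Matrix (JIdx k s) κ ℂ) :
    fullLinearized M D ρ (fromRows a 0) Ω (fromRows x 0) X
      = fromRows (jordanLinearized D.toBlocks₁₁ ρ a Ω x X) 0 := by
  have hg : perturbExp ρ 0 ≠ 0 := by rw [perturbExp]; omega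
  simp only [fullLinearized, linearizedResidual, jordanLinearized, fromBlocks_mul_fromRows,
    fromRows_mul, Matrix.zero_mul, Matrix.mul_zero, add_zero, fromRows_add_fromRows,
    levelProj_mul_fromRows, ite_self, mul_fromRows_zero D, if_neg hg, fromRows_sub_fromRows,
    sub_zero]

theorem toRows₂_fullLinearized (hρ : 0 < ρ) (x : Matrix (JIdx k s) κ ℂ) (y : Matrix β κ ℂ) :
    (fullLinearized M D ρ (fromRows a 0) Ω (fromRows x y) X).toRows₂ = M * y := by
  have hg : perturbExp ρ 0 ≠ 0 := by rw [perturbExp]; omega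
  have hh : restrictExp ρ 0 ≠ 0 := by simp [restrictExp]
  rw [fullLinearized, linearizedResidual,
    ← fromRows_toRows (D * (levelProj (scaleExp ρ ∘ fullLevel k s β) 0 * fromRows x y))]
  simp only [fromBlocks_mul_fromRows,
    fromRows_mul, Matrix.zero_mul, zero_add, fromRows_add_fromRows,
    levelProj_mul_fromRows, if_neg hg, if_neg hh, fromRows_sub_fromRows, add_zero, sub_zero,
    toRows₂_fromRows]

theorem fullForcing_fromRows (hρ : 2 ≤ ρ) :
    fullForcing D ρ (fromRows a 0) Ω = fromRows (jordanForcing D.toBlocks₁₁ ρ a Ω) 0 := by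
  have hg : perturbExp ρ 0 ≠ 0 := by rw [perturbExp]; omega
  have hg' : perturbExp ρ 0 ≠ 1 := by rw [perturbExp]; omega
  simp only [fullForcing, residualForcing, jordanForcing, fromRows_mul, Matrix.zero_mul,
    levelProj_mul_fromRows, ite_self, mul_fromRows_zero D, if_neg hg, if_neg hg',
    fromRows_sub_fromRows, sub_zero]

theorem eq_fromRows_of_fullLinearized_eq (hρ : 0 < ρ) (hM : IsUnit M)
    {x : Matrix (JIdx k s ⊕ β) κ ℂ} {e : Matrix (JIdx k s) κ ℂ}
    (h : fullLinearized M D ρ (fromRows a 0) Ω x X = fromRows e 0) :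
    x = fromRows x.toRows₁ 0 ∧ jordanLinearized D.toBlocks₁₁ ρ a Ω x.toRows₁ X = e := by
  have hy : x.toRows₂ = 0 := by
    refine eq_zero_of_isUnit_of_mul_eq_zero hM ?_
    rw [← toRows₂_fullLinearized (D := D) (a := a) (Ω := Ω) (X := X) hρ x.toRows₁ x.toRows₂,
      fromRows_toRows, h, toRows₂_fromRows]
  have hx : x = fromRows x.toRows₁ 0 := by rw [← hy, fromRows_toRows]
  refine ⟨hx, ?_⟩
  rw [hx, fullLinearized_fromRows hρ] at h
  exact (fromRows_inj h).1

end Embedding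

section ScaledSolution

variable {k : ℕ} {s : ℕ → ℕ} {β : Type*} [Fintype β] [DecidableEq β] {ρ : ℕ} {M : Matrix β β ℂ}
  {D : Matrix (JIdx k s ⊕ β) (JIdx k s ⊕ β) ℂ}

theorem mul_diagPow_mul_of_fullResidual_eq_zero {κ : Type*} [Fintype κ] {c : ℂ}
    {v : Matrix (JIdx k s ⊕ β) κ ℂ} {X : Matrix κ κ ℂ} (h : fullResidual M D ρ c v X = 0) :
    (fromBlocks (jordanN k s) 0 0 M + c ^ ρ • D) * (diagPow (scaleExp ρ ∘ fullLevel k s β) c * v)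
      = diagPow (scaleExp ρ ∘ fullLevel k s β) c * v * (c • X) := by
  refine mul_diagPow_mul_of_scaledResidual_eq_zero (e := fun p => min (fullLevel k s β p) ρ)
    ?_ (fun p => ?_) (fun p => ?_) h
  · ext (p | p) (q | q)
    · simp only [diagPow, diagonal_mul, mul_diagonal, fromBlocks_apply₁₁, jordanN, of_apply]
      split_ifs with hpq
      · have hlevel : fullLevel k s β (Sum.inl q) = fullLevel k s β (Sum.inl p) + 1 := hpq.2.1
        simp [hlevel, scaleExp]
      · rw [mul_zero, zero_mul]
    · simp [diagPow]
    · simp [diagPow]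
    · simp [diagPow, fullLevel, scaleExp]
  · simp only [Function.comp_apply, perturbExp]
    omega
  · simp only [Function.comp_apply, restrictExp, scaleExp]
    omega

variable {r r' : ℕ} {Φ : Matrix (Fin ρ × Fin (s ρ)) (Fin r) ℂ}
  {Φc : Matrix (Fin ρ × Fin (s ρ)) (Fin r') ℂ} {Ω : Matrix (Fin r) (Fin r) ℂ}
  {Ωc : Matrix (Fin r') (Fin r') ℂ} {P : Matrix (Fin r) (Fin ρ × Fin (s ρ)) ℂ}
  {Pc : Matrix (Fin r') (Fin ρ × Fin (s ρ)) ℂ}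

/-- The functional `x ↦ P * midBlk ρ x`, extended by zero to the full space, that normalizes the
scaled invariant subspace. -/
def midDual (k : ℕ) (s : ℕ → ℕ) (β : Type*) (P : Matrix (Fin r) (Fin ρ × Fin (s ρ)) ℂ) :
    Matrix (Fin r) (JIdx k s ⊕ β) ℂ :=
  fromCols (P * midBlk ρ (1 : Matrix (JIdx k s) (JIdx k s) ℂ)) 0

omit [DecidableEq β] in
theorem midDual_mul (x : Matrix (JIdx k s ⊕ β) (Fin r) ℂ) :
    midDual k s β P * x = P * midBlk ρ x.toRows₁ := by
  conv_lhs => rw [← fromRows_toRows x]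
  rw [midDual, fromCols_mul_fromRows, Matrix.zero_mul, add_zero, Matrix.mul_assoc, ← midBlk_mul,
    Matrix.one_mul]

theorem exists_analytic_fullResidual_eq_zero
    (hs : IsSpectralSplitting (blockCompanion ρ (S D.toBlocks₁₁ ρ)) Φ Φc Ω Ωc P Pc) (hρ : 2 ≤ ρ)
    (hρk : ρ ≤ k) (hW : IsUnit (W D.toBlocks₁₁ ρ)) (hW' : IsUnit (W D.toBlocks₁₁ (ρ + 1)))
    (hM : IsUnit M) :
    ∃ (v : ℂ → Matrix (JIdx k s ⊕ β) (Fin r) ℂ) (X : ℂ → Matrix (Fin r) (Fin r) ℂ),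
      AnalyticAtZero v ∧ AnalyticAtZero X ∧
      v 0 = fromRows (lead D.toBlocks₁₁ ρ (prodBlk Φ 0) Ω) 0 ∧ X 0 = Ω ∧
      ∀ᶠ c in 𝓝 0, fullResidual M D ρ c (v c) (X c) = 0 ∧ midDual k s β P * v c = 1 := by
  have hnorm : midDual k s β P * fromRows (lead D.toBlocks₁₁ ρ (prodBlk Φ 0) Ω)
      (0 : Matrix β (Fin r) ℂ) = 1 := by
    rw [midDual_mul, toRows₁_fromRows, midBlk_lead hρk hs.mul_left, hs.dual_mul_left]
  rw [← hnorm]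
  refine exists_analytic_solution ?_ fun x X hlin hx => ?_
  · refine (fullLinearized_fromRows (by omega) _).trans ?_
    rw [jordanLinearized_lead hρ hρk hW'
      (mul_prodBlk_zero_of_blockCompanion_mul_eq (by omega) hs.mul_left), fromRows_zero]
  · rw [← fromRows_zero] at hlin
    obtain ⟨hx', hlin'⟩ := eq_fromRows_of_fullLinearized_eq (by omega) hM hlin
    obtain ⟨hx₁, hX⟩ := eq_zero_of_jordanLinearized_eq_zero hs hlin' hρ hρk hW hW'
      (by rw [← midDual_mul, hx])
    exact ⟨by rw [hx', hx₁, fromRows_zero], hX⟩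

theorem first_order_of_fullResidual_eq_zero (hρ : 2 ≤ ρ) (hM : IsUnit M)
    {v : ℂ → Matrix (JIdx k s ⊕ β) (Fin r) ℂ} {X : ℂ → Matrix (Fin r) (Fin r) ℂ}
    {v₁ : Matrix (JIdx k s ⊕ β) (Fin r) ℂ} {X₁ : Matrix (Fin r) (Fin r) ℂ}
    {a : Matrix (JIdx k s) (Fin r) ℂ} (hv0 : v 0 = fromRows a 0) (hX0 : X 0 = Ω)
    (hv : HasDerivAtZero v v₁) (hX : HasDerivAtZero X X₁)
    (hsol : ∀ᶠ c in 𝓝 0, fullResidual M D ρ c (v c) (X c) = 0 ∧ midDual k s β P * v c = 1) :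
    v₁ = fromRows v₁.toRows₁ 0 ∧
      jordanLinearized D.toBlocks₁₁ ρ a Ω v₁.toRows₁ X₁ = jordanForcing D.toBlocks₁₁ ρ a Ω ∧
      P * midBlk ρ v₁.toRows₁ = 0 := by
  obtain ⟨hlin, hnorm⟩ := linearizedResidual_eq_residualForcing hv hX hsol
  rw [hv0, hX0] at hlin
  have hfull := eq_fromRows_of_fullLinearized_eq (by omega) hM
    (hlin.trans (fullForcing_fromRows hρ))
  exact ⟨hfull.1, hfull.2, by rw [← midDual_mul, hnorm]⟩

end ScaledSolution

section Coefficients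

variable {k n r r' ρ : ℕ} {s : ℕ → ℕ} {B : Matrix (JIdx k s) (JIdx k s) ℂ} (hρ : 2 ≤ ρ)
  (hρk : ρ ≤ k) (Xi : Matrix (Fin n) (JIdx k s) ℂ)

include hρk in
theorem colsFrom_mul_IG (m : ℕ) :
    colsFrom Xi ρ m * IG B ρ = colBlk Xi ρ m + colsFrom Xi (ρ + 1) m * G B ρ ρ := by
  rw [IG, colsFrom_mul_stack Xi m _ _ le_rfl (Nat.lt_succ_self ρ) hρk, Matrix.mul_one]

include hρ hρk

theorem mul_levelProj_mul_lead (Q : Matrix (Fin (s ρ)) (Fin r) ℂ) (Ω : Matrix (Fin r) (Fin r) ℂ)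
    {m : ℕ} (hm : m < ρ) :
    Xi * (levelProj (jordanLevel k s) (m + 1) * lead B ρ Q Ω)
      = colsFrom Xi ρ (m + 1) * IG B ρ * Q * Ω ^ m := by
  rw [mul_levelProj_mul_of_rowBlk_eq_zero hρ hρk Xi _ _
      fun j _ => rowBlk_lead_of_lt (by omega) _, rowBlk_lead_of_lt (by omega),
    rowBlk_lead_self hρk hm, rowsFrom_lead hm, Matrix.mul_zero, zero_add, colsFrom_mul_IG hρk]
  simp only [Matrix.add_mul, Matrix.mul_assoc]

theorem mul_levelProj_one_mul_lead_eq_H0 (Q : Matrix (Fin (s ρ)) (Fin r) ℂ)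
    (Ω : Matrix (Fin r) (Fin r) ℂ) :
    Xi * (levelProj (jordanLevel k s) 1 * lead B ρ Q Ω) = H0 B Xi ρ Q := by
  rw [mul_levelProj_mul_lead hρ hρk Xi Q Ω (m := 0) (by omega), pow_zero, Matrix.mul_one, H0]

theorem mul_add_levelProj_mul_eq_H1 {Φ : Matrix (Fin ρ × Fin (s ρ)) (Fin r) ℂ}
    {Φc : Matrix (Fin ρ × Fin (s ρ)) (Fin r') ℂ} {Ω X : Matrix (Fin r) (Fin r) ℂ}
    {Ωc : Matrix (Fin r') (Fin r') ℂ} {P : Matrix (Fin r) (Fin ρ × Fin (s ρ)) ℂ}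
    {Pc : Matrix (Fin r') (Fin ρ × Fin (s ρ)) ℂ} {x : Matrix (JIdx k s) (Fin r) ℂ}
    (hs : IsSpectralSplitting (blockCompanion ρ (S B ρ)) Φ Φc Ω Ωc P Pc)
    (h : jordanLinearized B ρ (lead B ρ (prodBlk Φ 0) Ω) Ω x X
      = jordanForcing B ρ (lead B ρ (prodBlk Φ 0) Ω) Ω)
    (hW : IsUnit (W B ρ)) (hW' : IsUnit (W B (ρ + 1))) (hx : P * midBlk ρ x = 0)
    {Qt₁ : Matrix (Fin r) (Fin (s ρ)) ℂ} {Qt₂ : Matrix (Fin r') (Fin (s ρ)) ℂ}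
    (hQt₂ : Qt₂ * S B ρ = Ωc ^ ρ * Qt₂) (hMc : IsUnit (Msum ρ Ωc Qt₂ (prodBlk Φc 0)))
    {Y : Matrix (Fin r') (Fin r) ℂ} (hY : Ωc * Y - Y * Ω
      + (Delta B ρ Ω Ωc (prodBlk Φ 0) (prodBlk Φc 0) Qt₁ Qt₂).toBlocks₂₁ = 0) :
    Xi * (levelProj (jordanLevel k s) 2 * lead B ρ (prodBlk Φ 0) Ω
        + levelProj (jordanLevel k s) 1 * x)
      = H1 B Xi ρ Ω (prodBlk Φ 0) (prodBlk Φc 0) Y := by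
  have hS := isUnit_S hρk hW hW'
  have hΩ : IsUnit Ω := hs.isUnit (isUnit_blockCompanion (by omega) hS)
  have hQ := mul_prodBlk_zero_of_blockCompanion_mul_eq (by omega) hs.mul_left
  rw [Matrix.mul_add, mul_levelProj_mul_lead hρ hρk Xi _ Ω (m := 1) hρ, pow_one,
    mul_levelProj_mul_of_rowBlk_eq_zero hρ hρk Xi x 1
      fun i hi => rowBlk_first_order_of_lt_pred h hρ hρk hΩ hi 1,
    rowsFrom_one_first_order h hρ hρk hΩ hS hQ hW',
    rowBlk_pred_one_first_order h hρ hρk hΩ hS hQ,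
    rowBlk_self_one_first_order hs h hρ hρk hW hW' hx Qt₁ hQt₂ hMc hY, H1,
    colsFrom_mul_stack Xi 1 _ _ le_rfl (by omega) (by omega), colsFrom_mul_IG hρk,
    colsFrom_mul_IG hρk]
  simp only [Matrix.add_mul, Matrix.mul_add, Matrix.mul_assoc]
  abel

end Coefficients

section Unscaling

variable {k n r r' ρ : ℕ} {s : ℕ → ℕ} {β : Type*} [Fintype β] [DecidableEq β]

/-- The basis of the invariant subspace in the original coordinates that corresponds to the scaled
solution `v` at `c = t ^ (1 / ρ)`; `V` is the basis that puts `A` in block diagonal form. -/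
def unscale {ι κ : Type*} (ρ : ℕ) (V : Matrix ι (JIdx k s ⊕ β) ℂ) (c : ℂ)
    (v : Matrix (JIdx k s ⊕ β) κ ℂ) : Matrix ι κ ℂ :=
  V * (diagPow (scaleExp ρ ∘ fullLevel k s β) c * v)

theorem analyticAtZero_unscale {ι κ : Type*} (V : Matrix ι (JIdx k s ⊕ β) ℂ)
    {v : ℂ → Matrix (JIdx k s ⊕ β) κ ℂ} (hv : AnalyticAtZero v) :
    AnalyticAtZero fun c => unscale ρ V c (v c) :=
  (analyticAtZero_const V).mul ((analyticAtZero_diagPow _).mul hv)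

theorem rank_unscale {ι : Type*} [Fintype ι] {V : Matrix ι (JIdx k s ⊕ β) ℂ}
    {V' : Matrix (JIdx k s ⊕ β) ι ℂ} (hV : V' * V = 1) {c : ℂ} (hc : c ≠ 0)
    {L : Matrix (Fin r) (JIdx k s ⊕ β) ℂ} {v : Matrix (JIdx k s ⊕ β) (Fin r) ℂ} (hv : L * v = 1) :
    (unscale ρ V c v).rank = r := by
  refine (rank_eq_card_of_mul_eq_one
    (L := L * diagPow (scaleExp ρ ∘ fullLevel k s β) c⁻¹ * V') ?_).trans (Fintype.card_fin r)
  rw [unscale, Matrix.mul_assoc, ← Matrix.mul_assoc V', hV, Matrix.one_mul, Matrix.mul_assoc,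
    ← Matrix.mul_assoc _ _ v, diagPow_inv_mul_diagPow _ hc, Matrix.one_mul, hv]

theorem add_smul_mul_eq_mul {ι ι' : Type*} [Fintype ι] [DecidableEq ι] [Fintype ι']
    {A D : Matrix ι ι ℂ} {V : Matrix ι ι' ℂ} {V' : Matrix ι' ι ℂ} {T : Matrix ι' ι' ℂ}
    (hA : A * V = V * T) (hV : V * V' = 1) (c : ℂ) :
    (A + c • D) * V = V * (T + c • (V' * D * V)) := by
  rw [Matrix.add_mul, hA, Matrix.mul_add, Matrix.mul_smul, Matrix.mul_assoc V',
    ← Matrix.mul_assoc V, hV, Matrix.one_mul, Matrix.smul_mul]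

theorem mul_unscale_of_fullResidual_eq_zero {ι : Type*} [Fintype ι] [DecidableEq ι]
    {A D : Matrix ι ι ℂ} {V : Matrix ι (JIdx k s ⊕ β) ℂ} {V' : Matrix (JIdx k s ⊕ β) ι ℂ}
    {lam0 : ℂ} {A22 : Matrix β β ℂ} (hV : V * V' = 1)
    (hA : A * V = V * fromBlocks (lam0 • 1 + jordanN k s) 0 0 A22) {c : ℂ}
    {v : Matrix (JIdx k s ⊕ β) (Fin r) ℂ} {X : Matrix (Fin r) (Fin r) ℂ}
    (h : fullResidual (A22 - lam0 • 1) (V' * D * V) ρ c v X = 0) :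
    (A + c ^ ρ • D) * unscale ρ V c v = unscale ρ V c v * (lam0 • 1 + c • X) := by
  have hshift : fromBlocks (lam0 • 1 + jordanN k s) 0 0 A22
      = lam0 • 1 + fromBlocks (jordanN k s) 0 0 (A22 - lam0 • 1) := by
    rw [← fromBlocks_one, fromBlocks_smul, fromBlocks_add]
    simp only [smul_zero, add_zero, add_sub_cancel]
  rw [unscale, ← Matrix.mul_assoc, add_smul_mul_eq_mul hA hV, Matrix.mul_assoc, hshift, add_assoc,
    Matrix.add_mul, mul_diagPow_mul_of_fullResidual_eq_zero h]
  simp only [Matrix.mul_add, Matrix.smul_mul, Matrix.mul_smul, Matrix.one_mul, Matrix.mul_one,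
    Matrix.mul_assoc]

variable (hρ : 2 ≤ ρ) (Xi : Matrix (Fin n) (JIdx k s) ℂ) (Xic : Matrix (Fin n) β ℂ)
include hρ

theorem unscale_zero_fromRows (x : Matrix (JIdx k s) (Fin r) ℂ) :
    unscale ρ (fromCols Xi Xic) 0 (fromRows x 0) = Xi * (levelProj (jordanLevel k s) 1 * x) := by
  rw [unscale, diagPow_zero, levelProj_mul_fromRows, ite_self, fromCols_mul_fromRows,
    Matrix.mul_zero, add_zero, levelProj_scaleExp (by omega)]

theorem hasDerivAtZero_unscale {v : ℂ → Matrix (JIdx k s ⊕ β) (Fin r) ℂ}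
    {a x : Matrix (JIdx k s) (Fin r) ℂ} (hv0 : v 0 = fromRows a 0)
    (hv : HasDerivAtZero v (fromRows x 0)) :
    HasDerivAtZero (fun c => unscale ρ (fromCols Xi Xic) c (v c))
      (Xi * (levelProj (jordanLevel k s) 2 * a + levelProj (jordanLevel k s) 1 * x)) := by
  have hderiv := ((hasDerivAtZero_diagPow (scaleExp ρ ∘ fullLevel k s β)).mul hv).const_mul
    (fromCols Xi Xic)
  rwa [hv0, diagPow_zero, levelProj_mul_fromRows, levelProj_mul_fromRows, ite_self, ite_self,
    fromRows_add_fromRows, add_zero, fromCols_mul_fromRows, Matrix.mul_zero, add_zero,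
    levelProj_scaleExp (by omega), levelProj_scaleExp (by omega)] at hderiv

end Unscaling

section InvariantSubspace

variable {k n r r' ρ : ℕ} {s : ℕ → ℕ} {β : Type*} [Fintype β] [DecidableEq β]
  {A D : Matrix (Fin n) (Fin n) ℂ} {Xi : Matrix (Fin n) (JIdx k s) ℂ} {Xic : Matrix (Fin n) β ℂ}
  {V' : Matrix (JIdx k s ⊕ β) (Fin n) ℂ} {lam0 : ℂ} {A22 : Matrix β β ℂ}
  {B : Matrix (JIdx k s) (JIdx k s) ℂ} {Φ : Matrix (Fin ρ × Fin (s ρ)) (Fin r) ℂ}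
  {Φc : Matrix (Fin ρ × Fin (s ρ)) (Fin r') ℂ} {Ω : Matrix (Fin r) (Fin r) ℂ}
  {Ωc : Matrix (Fin r') (Fin r') ℂ} {P : Matrix (Fin r) (Fin ρ × Fin (s ρ)) ℂ}
  {Pc : Matrix (Fin r') (Fin ρ × Fin (s ρ)) ℂ}

theorem isUnit_sub_smul_one (hlam0 : lam0 ∉ spectrum ℂ A22) :
    IsUnit (A22 - lam0 • 1) := by
  simpa only [neg_sub, Algebra.algebraMap_eq_smul_one] using (spectrum.notMem_iff.1 hlam0).neg

theorem exists_analytic_invariant_subspace (hV₁ : V' * fromCols Xi Xic = 1)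
    (hV₂ : fromCols Xi Xic * V' = 1)
    (hA : A * fromCols Xi Xic = fromCols Xi Xic * fromBlocks (lam0 • 1 + jordanN k s) 0 0 A22)
    (hlam0 : lam0 ∉ spectrum ℂ A22) (hB : (V' * D * fromCols Xi Xic).toBlocks₁₁ = B)
    (hρ : 2 ≤ ρ) (hρk : ρ ≤ k) (hW : IsUnit (W B ρ)) (hW' : IsUnit (W B (ρ + 1)))
    (hs : IsSpectralSplitting (Theta B ρ) Φ Φc Ω Ωc P Pc)
    {Qt₁ : Matrix (Fin r) (Fin (s ρ)) ℂ} {Qt₂ : Matrix (Fin r') (Fin (s ρ)) ℂ}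
    (hQt₁ : Qt₁ * S B ρ = Ω ^ ρ * Qt₁) (hQt₂ : Qt₂ * S B ρ = Ωc ^ ρ * Qt₂)
    (hM : IsUnit (Msum ρ Ω Qt₁ (prodBlk Φ 0))) (hMc : IsUnit (Msum ρ Ωc Qt₂ (prodBlk Φc 0)))
    {Y : Matrix (Fin r') (Fin r) ℂ} (hY : Ωc * Y - Y * Ω
      + (Delta B ρ Ω Ωc (prodBlk Φ 0) (prodBlk Φc 0) Qt₁ Qt₂).toBlocks₂₁ = 0) :
    ∃ (H : ℂ → Matrix (Fin n) (Fin r) ℂ) (X : ℂ → Matrix (Fin r) (Fin r) ℂ),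
      AnalyticAtZero H ∧ AnalyticAtZero X ∧ H 0 = H0 B Xi ρ (prodBlk Φ 0) ∧ X 0 = Ω ∧
      HasDerivAtZero H (H1 B Xi ρ Ω (prodBlk Φ 0) (prodBlk Φc 0) Y) ∧
      HasDerivAtZero X (Delta B ρ Ω Ωc (prodBlk Φ 0) (prodBlk Φc 0) Qt₁ Qt₂).toBlocks₁₁ ∧
      ∀ᶠ c in 𝓝 0, (A + c ^ ρ • D) * H c = H c * (lam0 • 1 + c • X c) ∧
        (c ≠ 0 → (H c).rank = r) := by
  subst hB
  have hunit := isUnit_sub_smul_one hlam0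
  obtain ⟨v, X, hv, hX, hv0, hX0, hsol⟩ :=
    exists_analytic_fullResidual_eq_zero hs hρ hρk hW hW' hunit
  obtain ⟨v₁, hv₁⟩ := hv.exists_hasDerivAtZero
  obtain ⟨X₁, hX₁⟩ := hX.exists_hasDerivAtZero
  obtain ⟨hfull, hlin, hnorm⟩ := first_order_of_fullResidual_eq_zero hρ hunit hv0 hX0 hv₁ hX₁ hsol
  rw [hfull] at hv₁
  refine ⟨fun c => unscale ρ (fromCols Xi Xic) c (v c), X, analyticAtZero_unscale _ hv, hX,
    ?_, hX0, ?_, ?_, hsol.mono fun c hc =>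
      ⟨mul_unscale_of_fullResidual_eq_zero hV₂ hA hc.1, fun hc0 => rank_unscale hV₁ hc0 hc.2⟩⟩
  · beta_reduce
    rw [hv0, unscale_zero_fromRows hρ, mul_levelProj_one_mul_lead_eq_H0 hρ hρk]
  · rw [← mul_add_levelProj_mul_eq_H1 hρ hρk Xi hs hlin hW hW' hnorm hQt₂ hMc hY]
    exact hasDerivAtZero_unscale hρ Xi Xic hv0 hv₁
  · rwa [← eq_Delta_toBlocks₁₁ hs hlin hρ hρk hW hW' hnorm Qt₂ hQt₁ hM]

end InvariantSubspace

section Asymptotics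

variable {m n p : Type*} {F G : ℝ → Matrix m n ℂ} {a b : ℝ}

theorem IsOPow.add (hF : IsOPow F a) (hG : IsOPow G a) : IsOPow (fun t => F t + G t) a :=
  fun i j => (hF i j).add (hG i j)

theorem IsOPow.neg (hF : IsOPow F a) : IsOPow (fun t => -F t) a := fun i j => (hF i j).neg_left

theorem IsOPow.mono (hF : IsOPow F a) (hab : b ≤ a) : IsOPow F b := by
  intro i j
  refine (hF i j).trans (IsBigO.of_bound 1 ?_)
  filter_upwards [Ioo_mem_nhdsGT (zero_lt_one' ℝ)] with t ht
  rw [one_mul, Real.norm_of_nonneg (Real.rpow_nonneg ht.1.le _),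
    Real.norm_of_nonneg (Real.rpow_nonneg ht.1.le _)]
  exact Real.rpow_le_rpow_of_exponent_ge ht.1 ht.2.le hab

theorem IsOPow.mul [Fintype n] {G : ℝ → Matrix n p ℂ} (hF : IsOPow F a) (hG : IsOPow G b) :
    IsOPow (fun t => F t * G t) (a + b) := by
  intro i j
  simp only [Matrix.mul_apply]
  refine IsBigO.fun_sum fun l _ => ((hF i l).mul (hG l j)).trans_eventuallyEq ?_
  filter_upwards [self_mem_nhdsWithin] with t ht
  exact (Real.rpow_add ht a b).symm

theorem IsOPow.congr (hF : IsOPow F a) (h : ∀ᶠ t in 𝓝[>] (0 : ℝ), G t = F t) : IsOPow G a :=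
  fun i j => (hF i j).congr' (h.mono fun t ht => by simp only [ht]) EventuallyEq.rfl

theorem IsOPow.tpow_smul (hF : IsOPow F b) (a : ℝ) : IsOPow (fun t => tpow t a • F t) (a + b) := by
  intro i j
  have htpow : (fun t => tpow t a) =O[𝓝[>] 0] fun t : ℝ => t ^ a :=
    IsBigO.of_bound 1 (Eventually.of_forall fun t => by rw [tpow, Complex.norm_real, one_mul])
  refine (htpow.mul (hF i j)).trans_eventuallyEq ?_
  filter_upwards [self_mem_nhdsWithin] with t ht
  exact (Real.rpow_add ht a b).symm

theorem isOPow_const (X : Matrix m n ℂ) : IsOPow (fun _ => X) 0 := by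
  intro i j
  simpa only [Real.rpow_zero] using isBigO_const_const (X i j) (one_ne_zero' ℝ) _

theorem isOPow_tpow_smul (X : Matrix m n ℂ) (a : ℝ) : IsOPow (fun t => tpow t a • X) a := by
  simpa only [add_zero] using (isOPow_const X).tpow_smul a

theorem isOPow_const_add_tpow_smul (X Y : Matrix m n ℂ) (ha : 0 ≤ a) :
    IsOPow (fun t => X + tpow t a • Y) 0 :=
  (isOPow_const X).add ((isOPow_tpow_smul Y a).mono ha)

theorem tendsto_tpow (ha : 0 < a) : Tendsto (fun t => tpow t a) (𝓝[>] 0) (𝓝 0) := by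
  have hrpow : Tendsto (fun t : ℝ => t ^ a) (𝓝[>] 0) (𝓝 0) := by
    simpa only [Real.zero_rpow ha.ne'] using
      (Real.continuousAt_rpow_const 0 a (Or.inr ha.le)).tendsto.mono_left nhdsWithin_le_nhds
  have h := (Complex.continuous_ofReal.tendsto 0).comp hrpow
  rwa [Complex.ofReal_zero] at h

theorem tpow_ne_zero {t : ℝ} (ht : 0 < t) (a : ℝ) : tpow t a ≠ 0 :=
  Complex.ofReal_ne_zero.2 (Real.rpow_pos_of_pos ht a).ne'

theorem tpow_pow {t : ℝ} (ht : 0 < t) (a : ℝ) (e : ℕ) : tpow t a ^ e = tpow t (a * e) := by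
  rw [tpow, tpow, ← Complex.ofReal_pow, Real.rpow_mul ht.le, Real.rpow_natCast]

variable {ρ : ℕ}

theorem tpow_one_div_pow_self {t : ℝ} (ht : 0 < t) (hρ : 0 < ρ) : tpow t (1 / ρ) ^ ρ = t := by
  rw [tpow_pow ht, one_div_mul_cancel (Nat.cast_ne_zero.2 hρ.ne'), tpow, Real.rpow_one]

theorem tpow_one_div_sq {t : ℝ} (ht : 0 < t) : tpow t (1 / ρ) ^ 2 = tpow t (2 / ρ) := by
  rw [tpow_pow ht, Nat.cast_two, one_div_mul_eq_div]

theorem isOPow_taylor {F : ℂ → Matrix m n ℂ} {F' : Matrix m n ℂ} (hF : AnalyticAtZero F)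
    (hF' : HasDerivAtZero F F') (hρ : 0 < ρ) :
    IsOPow (fun t => F (tpow t (1 / ρ)) - (F 0 + tpow t (1 / ρ) • F')) (2 / ρ) := by
  intro i j
  have hpos : (0 : ℝ) < 1 / ρ := by positivity
  refine ((isBigO_sq_of_analyticAt (hF i j) (hF' i j)).comp_tendsto (tendsto_tpow hpos)).trans ?_
  refine IsBigO.of_bound 1 ?_
  filter_upwards [self_mem_nhdsWithin] with t ht
  rw [Function.comp_apply, tpow_one_div_sq ht, tpow, Complex.norm_real, one_mul]

theorem isOPow_add_smul_taylor (X₀ : Matrix m n ℂ)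
    {F : ℂ → Matrix m n ℂ} {F' : Matrix m n ℂ} (hF : AnalyticAtZero F)
    (hF' : HasDerivAtZero F F') (hρ : 0 < ρ) :
    IsOPow (fun t => X₀ + tpow t (1 / ρ) • F (tpow t (1 / ρ))
      - (X₀ + tpow t (1 / ρ) • F 0 + tpow t (2 / ρ) • F')) (3 / ρ) := by
  have hexp : (1 / ρ + 2 / ρ : ℝ) = 3 / ρ := by ring
  have hmul := (isOPow_taylor hF hF' hρ).tpow_smul (1 / ρ)
  rw [hexp] at hmul
  refine hmul.congr ?_
  filter_upwards [self_mem_nhdsWithin] with t ht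
  rw [← tpow_one_div_sq ht, smul_sub, smul_add, smul_smul, sq, add_assoc,
    add_sub_add_left_eq_sub]

theorem isOPow_residual_of_mul_eq {r : Type*} [Fintype n] [Fintype r] {A D : Matrix n n ℂ}
    {H Ha : ℝ → Matrix n r ℂ} {C Ca : ℝ → Matrix r r ℂ} (hab : a ≤ b) (hb : 0 ≤ b)
    (hinv : ∀ᶠ t : ℝ in 𝓝[>] 0, (A + (t : ℂ) • D) * H t = H t * C t)
    (hC : IsOPow (fun t => C t - Ca t) b) (hH : IsOPow (fun t => H t - Ha t) a)
    (hCa : IsOPow Ca 0) (hHa : IsOPow Ha 0) :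
    IsOPow (fun t => (A + (t : ℂ) • D) * Ha t - Ha t * Ca t) a := by
  have hA : IsOPow (fun t : ℝ => A + (t : ℂ) • D) 0 := by
    simpa [tpow] using isOPow_const_add_tpow_smul A D zero_le_one
  have hC0 : IsOPow C 0 := by
    simpa using (hC.mono hb).add hCa
  have h₁ : IsOPow (fun t => -((A + (t : ℂ) • D) * (H t - Ha t))) a := by
    simpa only [zero_add] using (hA.mul hH).neg
  have h₂ : IsOPow (fun t => (H t - Ha t) * C t) a := by
    simpa only [add_zero] using hH.mul hC0
  have h₃ : IsOPow (fun t => Ha t * (C t - Ca t)) a := by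
    simpa only [zero_add] using hHa.mul (hC.mono hab)
  refine ((h₁.add h₂).add h₃).congr ?_
  filter_upwards [hinv] with t ht
  rw [Matrix.mul_sub, Matrix.sub_mul, Matrix.mul_sub, ht]
  abel

theorem exists_invariant_subspace_isOPow {n r : ℕ} {A D : Matrix (Fin n) (Fin n) ℂ} {lam0 : ℂ}
    {H : ℂ → Matrix (Fin n) (Fin r) ℂ} {X : ℂ → Matrix (Fin r) (Fin r) ℂ}
    {H₁ : Matrix (Fin n) (Fin r) ℂ} {X₁ : Matrix (Fin r) (Fin r) ℂ} (hρ : 0 < ρ)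
    (hH : AnalyticAtZero H) (hX : AnalyticAtZero X) (hH₁ : HasDerivAtZero H H₁)
    (hX₁ : HasDerivAtZero X X₁)
    (hinv : ∀ᶠ c in 𝓝 0, (A + c ^ ρ • D) * H c = H c * (lam0 • 1 + c • X c) ∧
      (c ≠ 0 → (H c).rank = r)) :
    (∃ (K : ℝ → Matrix (Fin n) (Fin r) ℂ) (C : ℝ → Matrix (Fin r) (Fin r) ℂ),
      (∀ᶠ t : ℝ in 𝓝[>] 0, (A + (t : ℂ) • D) * K t = K t * C t ∧ (K t).rank = r) ∧
      IsOPow (fun t => C t - (lam0 • 1 + tpow t (1 / ρ) • X 0 + tpow t (2 / ρ) • X₁)) (3 / ρ) ∧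
      IsOPow (fun t => K t - (H 0 + tpow t (1 / ρ) • H₁)) (2 / ρ)) ∧
    IsOPow (fun t => (A + (t : ℂ) • D) * (H 0 + tpow t (1 / ρ) • H₁)
      - (H 0 + tpow t (1 / ρ) • H₁)
        * (lam0 • 1 + tpow t (1 / ρ) • X 0 + tpow t (2 / ρ) • X₁)) (2 / ρ) := by
  have hpos : (0 : ℝ) < 1 / ρ := by positivity
  have hC := isOPow_add_smul_taylor (lam0 • 1) hX hX₁ hρ
  have hK := isOPow_taylor hH hH₁ hρ
  have hinv' : ∀ᶠ t : ℝ in 𝓝[>] 0, (A + (t : ℂ) • D) * H (tpow t (1 / ρ))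
      = H (tpow t (1 / ρ)) * (lam0 • 1 + tpow t (1 / ρ) • X (tpow t (1 / ρ))) ∧
        (H (tpow t (1 / ρ))).rank = r := by
    filter_upwards [(tendsto_tpow hpos).eventually hinv, self_mem_nhdsWithin] with t ht ht0
    rw [tpow_one_div_pow_self ht0 hρ] at ht
    exact ⟨ht.1, ht.2 (tpow_ne_zero ht0 _)⟩
  refine ⟨⟨_, _, hinv', hC, hK⟩, isOPow_residual_of_mul_eq (by gcongr; norm_num) (by positivity)
    (hinv'.mono fun _ ht => ht.1) hC hK ?_ (isOPow_const_add_tpow_smul _ _ hpos.le)⟩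
  exact (isOPow_const_add_tpow_smul _ _ hpos.le).add ((isOPow_tpow_smul _ _).mono (by positivity))

theorem isUnit_W_of_lt {k i : ℕ} {s : ℕ → ℕ} (B : Matrix (JIdx k s) (JIdx k s) ℂ) (hi : k < i) :
    IsUnit (W B i) := by
  have : IsEmpty (TIdx i k s) := ⟨fun p => hi.not_ge (p.1.2.1.trans p.1.2.2)⟩
  exact isUnit_of_subsingleton _

end Asymptotics

end JordanPert

end

open JordanPert

theorem theorem4p1_general
    {n k r r' ρ : ℕ} {s : ℕ → ℕ} {β : Type*} [Fintype β] [DecidableEq β]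
    (hρ : 2 ≤ ρ) (hρk : ρ ≤ k) {A D : Matrix (Fin n) (Fin n) ℂ} {lam0 : ℂ}
    {Xi Sg : Matrix (Fin n) (JIdx k s) ℂ} {Xic Sgc : Matrix (Fin n) β ℂ} {A22 : Matrix β β ℂ}
    (hinv₁ : (fromCols Sg Sgc)ᴴ * fromCols Xi Xic = 1)
    (hinv₂ : fromCols Xi Xic * (fromCols Sg Sgc)ᴴ = 1)
    (hA : A * fromCols Xi Xic = fromCols Xi Xic * fromBlocks (lam0 • 1 + jordanN k s) 0 0 A22)
    (hlam0 : lam0 ∉ spectrum ℂ A22)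
    {D11 : Matrix (JIdx k s) (JIdx k s) ℂ} (hD11 : D11 = Sgᴴ * D * Xi)
    (hW : IsUnit (W D11 ρ)) (hW' : IsUnit (W D11 (ρ + 1)))
    {Φ : Matrix (Fin ρ × Fin (s ρ)) (Fin r) ℂ} {Φc : Matrix (Fin ρ × Fin (s ρ)) (Fin r') ℂ}
    {Ω : Matrix (Fin r) (Fin r) ℂ} {Ωc : Matrix (Fin r') (Fin r') ℂ}
    (hΦ : Theta D11 ρ * Φ = Φ * Ω) (hΦc : Theta D11 ρ * Φc = Φc * Ωc)
    (hΦinv : ∃ P : Matrix (Fin r ⊕ Fin r') (Fin ρ × Fin (s ρ)) ℂ,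
      P * fromCols Φ Φc = 1 ∧ fromCols Φ Φc * P = 1)
    (hdisj : Disjoint (spectrum ℂ Ω) (spectrum ℂ Ωc))
    {Q1 : Matrix (Fin (s ρ)) (Fin r) ℂ} {Q2 : Matrix (Fin (s ρ)) (Fin r') ℂ}
    (hQ1 : ∀ x c, Q1 x c = Φ (⟨0, by omega⟩, x) c)
    (hQ2 : ∀ x c, Q2 x c = Φc (⟨0, by omega⟩, x) c)
    {Qt1 : Matrix (Fin r) (Fin (s ρ)) ℂ} {Qt2 : Matrix (Fin r') (Fin (s ρ)) ℂ}
    (hQt1 : Qt1 * S D11 ρ = Ω ^ ρ * Qt1) (hQt2 : Qt2 * S D11 ρ = Ωc ^ ρ * Qt2)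
    (hM : IsUnit (Msum ρ Ω Qt1 Q1)) (hMc : IsUnit (Msum ρ Ωc Qt2 Q2))
    {Y : Matrix (Fin r') (Fin r) ℂ}
    (hY : Ωc * Y - Y * Ω + (Delta D11 ρ Ω Ωc Q1 Q2 Qt1 Qt2).toBlocks₂₁ = 0) :
    (∃ (H : ℝ → Matrix (Fin n) (Fin r) ℂ) (C : ℝ → Matrix (Fin r) (Fin r) ℂ),
      (∀ᶠ t : ℝ in 𝓝[>] 0, (A + (t : ℂ) • D) * H t = H t * C t ∧ (H t).rank = r) ∧
      IsOPow (fun t => C t - (lam0 • 1 + tpow t (1 / ρ) • Ω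
        + tpow t (2 / ρ) • (Delta D11 ρ Ω Ωc Q1 Q2 Qt1 Qt2).toBlocks₁₁)) (3 / ρ) ∧
      IsOPow (fun t => H t - (H0 D11 Xi ρ Q1
        + tpow t (1 / ρ) • H1 D11 Xi ρ Ω Q1 Q2 Y)) (2 / ρ)) ∧
    IsOPow (fun t =>
      (A + (t : ℂ) • D) * (H0 D11 Xi ρ Q1 + tpow t (1 / ρ) • H1 D11 Xi ρ Ω Q1 Q2 Y)
        - (H0 D11 Xi ρ Q1 + tpow t (1 / ρ) • H1 D11 Xi ρ Ω Q1 Q2 Y)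
          * (lam0 • 1 + tpow t (1 / ρ) • Ω
            + tpow t (2 / ρ) • (Delta D11 ρ Ω Ωc Q1 Q2 Qt1 Qt2).toBlocks₁₁)) (2 / ρ) := by
  obtain rfl : Q1 = prodBlk Φ 0 := by
    ext x c
    exact (hQ1 x c).trans (prodBlk_apply Φ _ x c).symm
  obtain rfl : Q2 = prodBlk Φc 0 := by
    ext x c
    exact (hQ2 x c).trans (prodBlk_apply Φc _ x c).symm
  obtain ⟨P, hPl, hPr⟩ := hΦinv
  have hB : ((fromCols Sg Sgc)ᴴ * D * fromCols Xi Xic).toBlocks₁₁ = D11 := by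
    rw [conjTranspose_fromCols_eq_fromRows_conjTranspose, fromRows_mul, fromRows_mul_fromCols,
      toBlocks_fromBlocks₁₁, hD11]
  obtain ⟨H, X, hH, hX, hH0, hX0, hH1, hX1, hinv⟩ :=
    exists_analytic_invariant_subspace hinv₁ hinv₂ hA hlam0 hB hρ hρk hW hW'
      (.of_fromCols hΦ hΦc hdisj hPl hPr) hQt1 hQt2 hM hMc hY
  simpa only [hH0, hX0] using
    exists_invariant_subspace_isOPow (zero_lt_two.trans_le hρ) hH hX hH1 hX1 hinv

theorem theorem4p1
    (n k q r r' ρ : ℕ) (s : ℕ → ℕ)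
    (hk : 0 < s k) (hρ : 2 ≤ ρ) (hρk : ρ ≤ k)
    (A D : Matrix (Fin n) (Fin n) ℂ) (lam0 : ℂ)
    (Xi Sg : Matrix (Fin n) (JordanPert.JIdx k s) ℂ)
    (Xic Sgc : Matrix (Fin n) (Fin q) ℂ)
    (A22 : Matrix (Fin q) (Fin q) ℂ)
    -- `[Σ Σ_c] = [Ξ Ξ_c]^{-*}`
    (hinv₁ : (fromCols Sg Sgc)ᴴ * fromCols Xi Xic = 1)
    (hinv₂ : fromCols Xi Xic * (fromCols Sg Sgc)ᴴ = 1)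
    (hA : A * fromCols Xi Xic
      = fromCols Xi Xic * fromBlocks (lam0 • 1 + JordanPert.jordanN k s) 0 0 A22)
    (hlam0 : lam0 ∉ spectrum ℂ A22)
    (D11 : Matrix (JordanPert.JIdx k s) (JordanPert.JIdx k s) ℂ)
    (hD11 : D11 = Sgᴴ * D * Xi)
    -- `W_1, …, W_ρ` are invertible, and so is `W_{ρ+1}` if `ρ < k`
    (hW : ∀ i, 1 ≤ i → i ≤ ρ + 1 → i ≤ k → IsUnit (JordanPert.W D11 i))
    (Φ : Matrix (Fin ρ × Fin (s ρ)) (Fin r) ℂ) (Φc : Matrix (Fin ρ × Fin (s ρ)) (Fin r') ℂ)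
    (Ω : Matrix (Fin r) (Fin r) ℂ) (Ωc : Matrix (Fin r') (Fin r') ℂ)
    (hΦ : JordanPert.Theta D11 ρ * Φ = Φ * Ω)
    (hΦc : JordanPert.Theta D11 ρ * Φc = Φc * Ωc)
    (hΦinv : ∃ P : Matrix (Fin r ⊕ Fin r') (Fin ρ × Fin (s ρ)) ℂ,
      P * fromCols Φ Φc = 1 ∧ fromCols Φ Φc * P = 1)
    (hdisj : Disjoint (spectrum ℂ Ω) (spectrum ℂ Ωc))
    -- `Q_1`, `Q_2` are the top blocks of `Φ`, `Φ_c`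
    (Q1 : Matrix (Fin (s ρ)) (Fin r) ℂ) (Q2 : Matrix (Fin (s ρ)) (Fin r') ℂ)
    (hQ1 : ∀ x c, Q1 x c = Φ (⟨0, by omega⟩, x) c)
    (hQ2 : ∀ x c, Q2 x c = Φc (⟨0, by omega⟩, x) c)
    (Qt1 : Matrix (Fin r) (Fin (s ρ)) ℂ) (Qt2 : Matrix (Fin r') (Fin (s ρ)) ℂ)
    (hQt1 : Qt1 * JordanPert.S D11 ρ = Ω ^ ρ * Qt1)
    (hQt2 : Qt2 * JordanPert.S D11 ρ = Ωc ^ ρ * Qt2)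
    (hM : IsUnit (JordanPert.Msum ρ Ω Qt1 Q1))
    (hMc : IsUnit (JordanPert.Msum ρ Ωc Qt2 Q2))
    (Y : Matrix (Fin r') (Fin r) ℂ)
    (hY : Ωc * Y - Y * Ω + (JordanPert.Delta D11 ρ Ω Ωc Q1 Q2 Qt1 Qt2).toBlocks₂₁ = 0) :
    -- the first fractional-order coefficients of an exactly invariant subspace of `A + tD`
    (∃ (H : ℝ → Matrix (Fin n) (Fin r) ℂ) (C : ℝ → Matrix (Fin r) (Fin r) ℂ),
      (∀ᶠ t : ℝ in 𝓝[>] 0, (A + (t : ℂ) • D) * H t = H t * C t ∧ (H t).rank = r) ∧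
      JordanPert.IsOPow (fun t => C t - (lam0 • (1 : Matrix (Fin r) (Fin r) ℂ)
          + JordanPert.tpow t (1 / ρ) • Ω
          + JordanPert.tpow t (2 / ρ)
            • (JordanPert.Delta D11 ρ Ω Ωc Q1 Q2 Qt1 Qt2).toBlocks₁₁)) (3 / ρ) ∧
      JordanPert.IsOPow (fun t => H t - (JordanPert.H0 D11 Xi ρ Q1
          + JordanPert.tpow t (1 / ρ) • JordanPert.H1 D11 Xi ρ Ω Q1 Q2 Y)) (2 / ρ)) ∧
    -- the approximate invariance of `H_0 + t^{1/ρ} H_1`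
    JordanPert.IsOPow (fun t =>
      (A + (t : ℂ) • D) * (JordanPert.H0 D11 Xi ρ Q1
          + JordanPert.tpow t (1 / ρ) • JordanPert.H1 D11 Xi ρ Ω Q1 Q2 Y)
        - (JordanPert.H0 D11 Xi ρ Q1
            + JordanPert.tpow t (1 / ρ) • JordanPert.H1 D11 Xi ρ Ω Q1 Q2 Y)
          * (lam0 • (1 : Matrix (Fin r) (Fin r) ℂ)
            + JordanPert.tpow t (1 / ρ) • Ω
            + JordanPert.tpow t (2 / ρ)
              • (JordanPert.Delta D11 ρ Ω Ωc Q1 Q2 Qt1 Qt2).toBlocks₁₁)) (2 / ρ) := by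
  refine theorem4p1_general hρ hρk hinv₁ hinv₂ hA hlam0 hD11 (hW ρ (by omega) (by omega) hρk) ?_
    hΦ hΦc hΦinv hdisj hQ1 hQ2 hQt1 hQt2 hM hMc hY
  exact (le_or_gt (ρ + 1) k).elim (hW _ (by omega) le_rfl) (isUnit_W_of_lt D11)
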